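/- Let $\mathbb{H}_{\mathbb{C}}$ be the algebra of biquaternions $z=z_0+\sum_{k=1}^3 z_ke_k$, $z_k\in\mathbb{C}$ (Hamilton's units $e_1,e_2,e_3$ with $e_k^2=e_1e_2e_3=-1$, commuting with $\mathrm{i}\in\mathbb{C}$), with conjugation $\overline{z}=z_0-\sum_{k=1}^3z_ke_k$. A function $u=u_0+\sum_k u_ke_k$ belongs to a space $\mathscr{F}(G;\mathbb{H}_{\mathbb{C}})$ if $u_0,\dots,u_3\in\mathscr{F}(G)$. Let $\mathbf{D}=\sum_{k=1}^3e_k\,\partial/\partial x_k$, acting from the left. Let $G\subset\mathbb{R}^3$ be a bounded domain, let $A=(a_1,a_2,a_3,a_4)\in (L_\infty(G;\mathbb{H}_{\mathbb{C}}))^4$, and put $$\mathbf{Q}_Aw=wa_1+\overline{w}\,a_2+a_3w+a_4\overline{w}.$$ A function $g\in L_{1,loc}(G;\mathbb{H}_{\mathbb{C}})$ is the weak $\mathbf{D}$-derivative of $u\in L_{1,loc}(G;\mathbb{H}_{\mathbb{C}})$ if $\int_G\overline{u}\,(\mathbf{D}\varphi)=\int_G\overline{g}\,\varphi$ for all $\varphi\in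 C_0^\infty(G;\mathbb{H}_{\mathbb{C}})$; then $w\in L_p(G;\mathbb{H}_{\mathbb{C}})$ is a weak solution of $(\mathbf{D}-\mathbf{Q}_A)w=v$ if its weak $\mathbf{D}$-derivative is $\mathbf{Q}_Aw+v$. Let $\mathfrak{V}_A^p(G;\mathbb{H}_{\mathbb{C}})$ be the space of all weak solutions $w\in L_p(G;\mathbb{H}_{\mathbb{C}})$ of $(\mathbf{D}-\mathbf{Q}_A)w=0$. For $0<\epsilon\le 1$, write $w\in C^{0,\epsilon}_{bloc}(G;\mathbb{H}_{\mathbb{C}})$ if $w$, after modification on a null set, is H\"older continuous with exponent $\epsilon$ on $\overline{B}$ for every ball $B$ with $\overline{B}\subset G$. Let $\frac32<p<\infty$, and put $p^*=\frac{3p}{3-p}$ if $p<3$. **Nonhomogeneous equation.** Let $p\le q<\infty$, $q>3$, $v\in L_q(G;\mathbb{H}_{\mathbb{C}})$, and let $w\in L_p(G;\mathbb{H}_{\mathbb{C}})$ be a weak solution of $(\mathbf{D}-\mathbf{Q}_A)w=v$. (i) If $p<3$, then $w\in C^{0,1-\frac3r}_{bloc}(G;\mathbb{H}_{\mathbb{C}})$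 for all $3<r<\min\{p^*,q\}$. (ii) If $p\ge 3$, then $w\in C^{0,1-\frac3r}_{bloc}(G;\mathbb{H}_{\mathbb{C}})$ for all $3<r\le q$. **Homogeneous equation.** (i) If $p<3$, then $\mathfrak{V}_A^p(G;\mathbb{H}_{\mathbb{C}})\subset C^{0,1-\frac3r}_{bloc}(G;\mathbb{H}_{\mathbb{C}})$ for all $3<r<p^*$. (ii) If $p\ge 3$, then $\mathfrak{V}_A^p(G;\mathbb{H}_{\mathbb{C}})\subset C^{0,1-\frac3r}_{bloc}(G;\mathbb{H}_{\mathbb{C}})$ for all $3<r<\infty$. -/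

import Mathlib

open MeasureTheory
open scoped ContDiff ENNReal

noncomputable section

namespace BiquatVekua

/-- Three-dimensional Euclidean space. -/
abbrev E3 : Type := EuclideanSpace ℝ (Fin 3)

/-- The algebra of biquaternions (complex quaternions): Hamilton's quaternions with complex
coefficients, `e₁² = e₂² = e₃² = e₁e₂e₃ = -1`. On this type `star` is the quaternionic
conjugation `p₀ + p⃗ ↦ p₀ - p⃗` (the complex coefficients are not conjugated). -/
abbrev HC : Type := QuaternionAlgebra ℂ (-1) 0 (-1)

/-- The complex components `z₀, z₁, z₂, z₃` of a biquaternion. -/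
def comp (k : Fin 4) (z : HC) : ℂ := ![z.re, z.imI, z.imJ, z.imK] k

/-- The imaginary units: `unit 0 = e₁`, `unit 1 = e₂`, `unit 2 = e₃`. -/
def unit : Fin 3 → HC := ![⟨0, 1, 0, 0⟩, ⟨0, 0, 1, 0⟩, ⟨0, 0, 0, 1⟩]

/-- `u ∈ L_p(G; HC)`: every component belongs to `L_p(G)`. Functions are total; only their
values on `G` matter. -/
def MemLpOn (G : Set E3) (p : ℝ≥0∞) (u : E3 → HC) : Prop :=
  ∀ k, MemLp (fun x => comp k (u x)) p (volume.restrict G)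

/-- `u ∈ L_{1,loc}(G; HC)`. -/
def LocIntegrableOn (G : Set E3) (u : E3 → HC) : Prop :=
  ∀ k, LocallyIntegrableOn (fun x => comp k (u x)) G volume

/-- The componentwise integral over `G` of a biquaternionic function. -/
def integralOn (G : Set E3) (u : E3 → HC) : HC :=
  ⟨∫ x in G, (u x).re, ∫ x in G, (u x).imI, ∫ x in G, (u x).imJ, ∫ x in G, (u x).imK⟩

/-- The partial derivative `∂u/∂x_j`, taken componentwise. -/
def partialDeriv (j : Fin 3) (u : E3 → HC) (x : E3) : HC :=
  let d : Fin 4 → ℂ := fun k =>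
    fderiv ℝ (fun y => comp k (u y)) x (EuclideanSpace.single j (1 : ℝ))
  ⟨d 0, d 1, d 2, d 3⟩

/-- The Moisil-Theodorescu operator `D = e₁ ∂₁ + e₂ ∂₂ + e₃ ∂₃` acting from the left on smooth
functions. -/
def diracOp (u : E3 → HC) (x : E3) : HC := ∑ j, unit j * partialDeriv j u x

/-- `φ ∈ C₀^∞(G; HC)`: smooth with compact support contained in `G`. -/
def IsTest (G : Set E3) (φ : E3 → HC) : Prop :=
  (∀ k, ContDiff ℝ ∞ (fun x => comp k (φ x))) ∧ HasCompactSupport φ ∧ tsupport φ ⊆ G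

/-- `g` is a weak `D`-derivative of `u` in `G`: both are in `L_{1,loc}(G; HC)` and
`∫_G ū (Dφ) = ∫_G ḡ φ` for all `φ ∈ C₀^∞(G; HC)`. -/
def IsWeakDirac (G : Set E3) (u g : E3 → HC) : Prop :=
  LocIntegrableOn G u ∧ LocIntegrableOn G g ∧
    ∀ φ : E3 → HC, IsTest G φ →
      integralOn G (fun x => star (u x) * diracOp φ x) =
        integralOn G (fun x => star (g x) * φ x)

/-- `Q_A w = w a₁ + w̄ a₂ + a₃ w + a₄ w̄`, where `A 0, A 1, A 2, A 3` are `a₁, a₂, a₃, a₄`. -/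
def vekuaQ (A : Fin 4 → E3 → HC) (w : E3 → HC) (x : E3) : HC :=
  w x * A 0 x + star (w x) * A 1 x + A 2 x * w x + A 3 x * star (w x)

/-- `w ∈ L_p(G; HC)` is a weak solution of `(D - Q_A) w = v` in `G`, that is, `Q_A w + v` is the
weak `D`-derivative of `w`. -/
def IsWeakSol (G : Set E3) (A : Fin 4 → E3 → HC) (p : ℝ≥0∞) (w v : E3 → HC) : Prop :=
  MemLpOn G p w ∧ IsWeakDirac G w (fun x => vekuaQ A w x + v x)

/-- The Vekua-Bergman space: all weak solutions `w ∈ L_p(G; HC)` of `(D - Q_A) w = 0`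
(as a set of functions, closed under equality a.e. in `G`). -/
def vekuaBergman (G : Set E3) (A : Fin 4 → E3 → HC) (p : ℝ≥0∞) : Set (E3 → HC) :=
  {w | IsWeakSol G A p w 0}

/-- The b-locally Hölder class `C^{0,ε}_{bloc}(G; HC)`, as a class of functions modulo equality
a.e. in `G`: one representative `u` is Hölder continuous with exponent `ε` (componentwise) on
the closure of every ball whose closure lies in `G`. -/
def blocHolder (G : Set E3) (ε : ℝ) : Set (E3 → HC) :=
  {w | ∃ u : E3 → HC, w =ᵐ[volume.restrict G] u ∧
    ∀ (c : E3) (R : ℝ), 0 < R → Metric.closedBall c R ⊆ G →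
      ∀ k, ∃ C, HolderOnWith C ε.toNNReal (fun x => comp k (u x)) (Metric.closedBall c R)}

/-- The Sobolev exponent `p* = 3p / (3 - p)` in dimension three, for `p < 3`. -/
def sobolevExp (p : ℝ) : ℝ := 3 * p / (3 - p)

end BiquatVekua

end

noncomputable section

namespace BiquatVekua

open Filter Topology Metric Set
open scoped NNReal

/-! ### The regularised Cauchy kernel -/

/-! The Cauchy integral formula for `D` turns a weak solution into a potential, and two mapping
properties of the Cauchy kernel do the rest. Let K_t be the field with components `fieldKer t j`. It
is smooth for t > 0 and curl-free, with divergence 3 P_t, where P_t is `peakKer t`. If g is the weak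
`D`-derivative of u and η is a cutoff, testing with y ↦ η(y) K_t(x - y) gives that 3 P_t * (η ū) is
the convolution of K_t with the density η ḡ - ū ∇η, multiplied from the right
(`integral_peakKer_eq_potentialReg`). As t → 0 the peaks tend to a multiple of the Dirac mass, so η
ū is a.e. a constant multiple of the potential of that density (`ae_eq_potential`).

The kernel is bounded by |z|⁻², and this lies in L_a near the origin exactly when a < 3/2. Young's
inequality therefore sends compactly supported L_p densities to local L_r whenever 1/r > 1/p - 1/3
and r > p (`memLp_potentialReg_restrict_ball`). The endpoint r = p* is never needed, so no
Hardy-Littlewood-Sobolev inequality enters. For r > 3 the conjugate exponent s is below 3/2; by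
homogeneity the L_s modulus of continuity of the kernel at h is a multiple of |h|^(3/s - 2) = |h|^(1
- 3/r), so potentials of L_r densities are Hölder continuous (`exists_holderWith_potentialReg`).

Bounded coefficients make `vekuaQ A` preserve every L_s. Since p > 3/2 means p* > 3, a single gain
of integrability puts w, and hence Q_A w + v, locally in L_r with 3 < r < p*, and the Hölder bound
applies. For p ≥ 3 the exponent is first lowered to one below 3 whose Sobolev exponent exceeds r.
The representatives on balls are glued in `mem_blocHolder_of_local`. -/

/-- The `j`-th component of the regularised Cauchy kernel `z (|z|² + t)^{-3/2}`. For `t = 0` this is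
the Cauchy kernel up to a constant factor. -/
def fieldKer (t : ℝ) (j : Fin 3) (z : E3) : ℝ := z j * (‖z‖ ^ 2 + t) ^ (-(3 / 2) : ℝ)

/-- A third of the divergence of the regularised Cauchy kernel, an approximate identity. -/
def peakKer (t : ℝ) (z : E3) : ℝ := t * (‖z‖ ^ 2 + t) ^ (-(5 / 2) : ℝ)

/-- The function `|z|⁻²` cut off outside the ball of radius `R`. -/
def nearKer (R : ℝ) : E3 → ℝ := (ball 0 R).indicator fun z => (‖z‖ ^ 2)⁻¹

/-- The function `|z|⁻³` cut off inside the ball of radius `R`. -/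
def farKer (R : ℝ) : E3 → ℝ := (ball 0 R)ᶜ.indicator fun z => (‖z‖ ^ 3)⁻¹

lemma abs_coord_le (z : E3) (j : Fin 3) : |z j| ≤ ‖z‖ := by
  simpa using PiLp.norm_apply_le z j

lemma sq_rpow_neg_three_halves {x : ℝ} (hx : 0 ≤ x) :
    (x ^ 2) ^ (-(3 / 2) : ℝ) = (x ^ 3)⁻¹ := by
  rw [← Real.rpow_natCast x 2, ← Real.rpow_mul hx, ← Real.rpow_natCast x 3, ← Real.rpow_neg hx]
  norm_num

lemma fieldKer_zero (j : Fin 3) (z : E3) : fieldKer 0 j z = z j * (‖z‖ ^ 3)⁻¹ := by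
  rw [fieldKer, add_zero, sq_rpow_neg_three_halves (norm_nonneg z)]

lemma abs_fieldKer_le {t : ℝ} (ht : 0 ≤ t) (j : Fin 3) (z : E3) :
    |fieldKer t j z| ≤ (‖z‖ ^ 2)⁻¹ := by
  rcases eq_or_ne z 0 with rfl | hz
  · simp [fieldKer]
  have hz' : 0 < ‖z‖ := norm_pos_iff.2 hz
  have h1 : (‖z‖ ^ 2 + t) ^ (-(3 / 2) : ℝ) ≤ (‖z‖ ^ 2) ^ (-(3 / 2) : ℝ) :=
    Real.rpow_le_rpow_of_nonpos (by positivity) (by linarith) (by norm_num)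
  rw [sq_rpow_neg_three_halves hz'.le] at h1
  have h0 : 0 ≤ (‖z‖ ^ 2 + t) ^ (-(3 / 2) : ℝ) := by positivity
  rw [fieldKer, abs_mul, abs_of_nonneg h0]
  calc |z j| * (‖z‖ ^ 2 + t) ^ (-(3 / 2) : ℝ) ≤ ‖z‖ * (‖z‖ ^ 3)⁻¹ := by
        gcongr; exact abs_coord_le z j
    _ = _ := by field_simp

@[fun_prop]
lemma measurable_fieldKer (t : ℝ) (j : Fin 3) : Measurable (fieldKer t j) := by
  unfold fieldKer
  have : Measurable fun z : E3 => z j := by fun_prop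
  fun_prop

@[fun_prop]
lemma measurable_peakKer (t : ℝ) : Measurable (peakKer t) := by
  unfold peakKer
  fun_prop

lemma measurable_nearKer (R : ℝ) : Measurable (nearKer R) :=
  Measurable.indicator (by fun_prop) measurableSet_ball

lemma measurable_farKer (R : ℝ) : Measurable (farKer R) :=
  Measurable.indicator (by fun_prop) measurableSet_ball.compl

lemma nearKer_nonneg (R : ℝ) (z : E3) : 0 ≤ nearKer R z :=
  indicator_nonneg (fun _ _ => by positivity) _

lemma farKer_nonneg (R : ℝ) (z : E3) : 0 ≤ farKer R z :=
  indicator_nonneg (fun _ _ => by positivity) _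

/-- Splits the kernel bound into an integrable part and a bounded part, so potentials of merely
integrable densities can be handled. -/
lemma inv_sq_le_nearKer_add_one (z : E3) : (‖z‖ ^ 2)⁻¹ ≤ nearKer 1 z + 1 := by
  by_cases hz : z ∈ ball (0 : E3) 1
  · simp [nearKer, hz]
  · have : 1 ≤ ‖z‖ := by simpa using hz
    rw [nearKer, indicator_of_notMem hz, zero_add]
    exact inv_le_one_of_one_le₀ (one_le_pow₀ this)

/-- In polar coordinates the integral becomes that of y^(2 - 2a) over (0, R), which converges
because 2 - 2a > -1. -/
lemma memLp_nearKer (R : ℝ) {a : ℝ} (ha : 0 < a) (ha' : a < 3 / 2) :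
    MemLp (nearKer R) (ENNReal.ofReal a) volume := by
  rcases le_or_gt R 0 with hR | hR
  · have : nearKer R = 0 := by
      ext z; simp [nearKer, ball_eq_empty.2 hR]
    rw [this]; exact MemLp.zero
  rw [← integrable_norm_rpow_iff (measurable_nearKer R).aestronglyMeasurable
    (by simpa using ha) ENNReal.ofReal_ne_top, ENNReal.toReal_ofReal ha.le]
  have h1 : (fun z => ‖nearKer R z‖ ^ a) =
      (ball (0 : E3) R).indicator fun z => (fun y : ℝ => ((y ^ 2)⁻¹) ^ a) ‖z‖ := by
    ext z
    by_cases hz : z ∈ ball (0 : E3) R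
    · rw [Real.norm_of_nonneg (nearKer_nonneg R z)]; simp only [nearKer, indicator_of_mem hz]
    · simp [nearKer, indicator_of_notMem hz, ha.ne']
  rw [h1, integrable_indicator_iff measurableSet_ball]
  refine (integrableOn_fun_norm_addHaar volume (f := fun y : ℝ => ((y ^ 2)⁻¹) ^ a)).2 ?_
  rw [finrank_euclideanSpace_fin]
  refine ((intervalIntegral.integrableOn_Ioo_rpow_iff (s := 2 - 2 * a) hR).2 (by linarith)).congr_fun
    (fun y hy => ?_) measurableSet_Ioo
  have hy0 : 0 < y := hy.1
  simp only [Nat.add_one_sub_one, smul_eq_mul]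
  rw [← Real.rpow_natCast y 2, ← Real.rpow_neg hy0.le, ← Real.rpow_mul hy0.le,
    ← Real.rpow_add hy0]
  congr 1; push_cast; ring

lemma integrable_nearKer (R : ℝ) : Integrable (nearKer R) volume := by
  have := memLp_nearKer R one_pos (by norm_num)
  rwa [ENNReal.ofReal_one, memLp_one_iff_integrable] at this

lemma memLp_farKer {R : ℝ} (hR : 0 < R) {a : ℝ} (ha : 1 < a) :
    MemLp (farKer R) (ENNReal.ofReal a) volume := by
  have ha0 : 0 < a := by linarith
  rw [← integrable_norm_rpow_iff (measurable_farKer R).aestronglyMeasurable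
    (by simpa using ha0) ENNReal.ofReal_ne_top, ENNReal.toReal_ofReal ha0.le]
  have h1 : (fun z => ‖farKer R z‖ ^ a) =
      fun z : E3 => (fun y : ℝ => (Ici R).indicator (fun y => ((y ^ 3)⁻¹) ^ a) y) ‖z‖ := by
    ext z
    rw [Real.norm_of_nonneg (farKer_nonneg R z)]
    by_cases hz : z ∈ ball (0 : E3) R
    · have : ‖z‖ ∉ Ici R := by simpa using hz
      simp [farKer, this, hz, ha0.ne']
    · have : ‖z‖ ∈ Ici R := by simpa using hz
      simp only [farKer, indicator_of_mem this]
      rw [indicator_of_mem (by simpa using hz)]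
  rw [h1, integrable_fun_norm_addHaar volume, finrank_euclideanSpace_fin]
  have h2 : IntegrableOn ((Ici R).indicator fun y : ℝ => y ^ (2 - 3 * a)) (Ioi 0) := by
    refine Integrable.integrableOn ?_
    rw [integrable_indicator_iff measurableSet_Ici]
    exact (integrableOn_Ici_iff_integrableOn_Ioi (by simp)).2 (integrableOn_Ioi_rpow_of_lt (by linarith) hR)
  refine h2.congr_fun (fun y hy => ?_) measurableSet_Ioi
  have hy0 : 0 < y := hy
  by_cases hyR : y ∈ Ici R
  · simp only [indicator_of_mem hyR, Nat.add_one_sub_one, smul_eq_mul]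
    rw [← Real.rpow_natCast y 2, ← Real.rpow_natCast y 3, ← Real.rpow_neg hy0.le,
      ← Real.rpow_mul hy0.le, ← Real.rpow_add hy0]
    congr 1; push_cast; ring
  · simp [indicator_of_notMem hyR]

lemma peakKer_nonneg {t : ℝ} (ht : 0 ≤ t) (z : E3) : 0 ≤ peakKer t z := by
  unfold peakKer; positivity

/-- With t = c⁻² the peaks are the mass-preserving dilations of a single profile. This is why the
limit t → 0 is always taken as c → ∞. -/
lemma peakKer_inv_sq {c : ℝ} (hc : 0 < c) (z : E3) :
    peakKer (c ^ 2)⁻¹ z = c ^ 3 * peakKer 1 (c • z) := by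
  have h1 : ‖c • z‖ ^ 2 + 1 = c ^ 2 * (‖z‖ ^ 2 + (c ^ 2)⁻¹) := by
    rw [norm_smul, Real.norm_of_nonneg hc.le, mul_pow]; field_simp
  have h2 : (c ^ 2) ^ (-(5 / 2) : ℝ) = (c ^ 5)⁻¹ := by
    rw [← Real.rpow_natCast c 2, ← Real.rpow_mul hc.le, ← Real.rpow_natCast c 5,
      ← Real.rpow_neg hc.le]
    norm_num
  rw [peakKer, peakKer, h1, Real.mul_rpow (by positivity) (by positivity), h2]
  field_simp

lemma integrable_peakKer_one : Integrable (peakKer 1) volume := by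
  have := integrable_rpow_neg_one_add_norm_sq (E := E3) (μ := volume) (r := 5)
    (by rw [finrank_euclideanSpace_fin]; norm_num)
  refine this.congr (ae_of_all _ fun z => ?_)
  simp only [peakKer, one_mul, add_comm (1 : ℝ)]
  norm_num

lemma integral_peakKer_one_pos : 0 < ∫ z, peakKer 1 z := by
  rw [integral_pos_iff_support_of_nonneg (peakKer_nonneg zero_le_one) integrable_peakKer_one]
  have : Function.support (peakKer 1) = univ := by
    ext z
    simp only [Function.mem_support, mem_univ, iff_true, peakKer]
    positivity
  rw [this]; simp

lemma peakKer_le {t : ℝ} (ht : 0 < t) (z : E3) : peakKer t z ≤ t * t ^ (-(5 / 2) : ℝ) := by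
  unfold peakKer
  gcongr t * ?_
  exact Real.rpow_le_rpow_of_nonpos ht (by nlinarith [sq_nonneg ‖z‖]) (by norm_num)

lemma tendsto_fieldKer (j : Fin 3) (z : E3) :
    Tendsto (fun c : ℝ => fieldKer (c ^ 2)⁻¹ j z) atTop (𝓝 (fieldKer 0 j z)) := by
  rcases eq_or_ne z 0 with rfl | hz
  · simp [fieldKer]
  have hz' : 0 < ‖z‖ := norm_pos_iff.2 hz
  have h1 : Tendsto (fun c : ℝ => (c ^ 2)⁻¹) atTop (𝓝 0) :=
    (tendsto_pow_atTop two_ne_zero).inv_tendsto_atTop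
  have h2 : ContinuousAt (fun t => fieldKer t j z) 0 := by
    unfold fieldKer
    refine continuousAt_const.mul (ContinuousAt.rpow_const (by fun_prop) (Or.inl ?_))
    positivity
  exact h2.tendsto.comp h1

/-! ### The potential operator and the representation formula -/

/-- The regularised potential of a vector density. -/
def potentialReg (t : ℝ) (g : Fin 3 → E3 → ℂ) (x : E3) : ℂ :=
  ∫ y, ∑ j, fieldKer t j (x - y) • g j y

lemma norm_sum_fieldKer_smul_le {t : ℝ} (ht : 0 ≤ t) (g : Fin 3 → E3 → ℂ) (x y : E3) :
    ‖∑ j, fieldKer t j (x - y) • g j y‖ ≤ (‖x - y‖ ^ 2)⁻¹ * ∑ j, ‖g j y‖ := by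
  refine (norm_sum_le _ _).trans ?_
  rw [Finset.mul_sum]
  refine Finset.sum_le_sum fun j _ => ?_
  rw [norm_smul, Real.norm_eq_abs]
  gcongr
  exact abs_fieldKer_le ht j _

/-- A majorant independent of t, serving both Fubini and dominated convergence as t → 0. -/
lemma integrable_prod_inv_sq {ψ G : E3 → ℝ} {M : ℝ} (hψ : Integrable ψ volume)
    (hM : ∀ x, |ψ x| ≤ M) (hG : Integrable G volume) :
    Integrable (fun p : E3 × E3 => |ψ p.1| * ((‖p.1 - p.2‖ ^ 2)⁻¹ * |G p.2|))
      (volume.prod volume) := by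
  have h1 : Integrable (fun p : E3 × E3 => M * (|G p.2| * nearKer 1 (p.1 - p.2)))
      (volume.prod volume) :=
    ((Integrable.convolution_integrand (ContinuousLinearMap.mul ℝ ℝ) hG.abs
      (integrable_nearKer 1))).const_mul M
  have h2 : Integrable (fun p : E3 × E3 => |ψ p.1| * |G p.2|) (volume.prod volume) :=
    hψ.abs.mul_prod hG.abs
  refine (h1.add h2).mono' ?_ (ae_of_all _ fun p => ?_)
  · have hψ' := (hψ.abs.aestronglyMeasurable).comp_fst (ν := (volume : Measure E3))
    have hG' := (hG.abs.aestronglyMeasurable).comp_snd (μ := (volume : Measure E3))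
    refine hψ'.mul (AEStronglyMeasurable.mul ?_ hG')
    exact Measurable.aestronglyMeasurable (by fun_prop)
  · have h0 : 0 ≤ (‖p.1 - p.2‖ ^ 2)⁻¹ := by positivity
    rw [Real.norm_of_nonneg (by positivity), Pi.add_apply]
    have h3 := inv_sq_le_nearKer_add_one (p.1 - p.2)
    have h4 := nearKer_nonneg 1 (p.1 - p.2)
    calc |ψ p.1| * ((‖p.1 - p.2‖ ^ 2)⁻¹ * |G p.2|)
        ≤ |ψ p.1| * ((nearKer 1 (p.1 - p.2) + 1) * |G p.2|) := by gcongr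
      _ = |ψ p.1| * (|G p.2| * nearKer 1 (p.1 - p.2)) + |ψ p.1| * |G p.2| := by ring
      _ ≤ _ := by
        gcongr
        exact hM _

lemma aestronglyMeasurable_prod_fieldKer (t : ℝ) {g : Fin 3 → E3 → ℂ}
    (hg : ∀ j, AEStronglyMeasurable (g j) volume) :
    AEStronglyMeasurable (fun p : E3 × E3 => ∑ j, fieldKer t j (p.1 - p.2) • g j p.2)
      (volume.prod volume) := by
  refine Finset.aestronglyMeasurable_fun_sum _ fun j _ => ?_
  refine AEStronglyMeasurable.smul (f := fun p : E3 × E3 => fieldKer t j (p.1 - p.2)) ?_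
    ((hg j).comp_snd)
  exact Measurable.aestronglyMeasurable (by fun_prop)

lemma integrable_sum_norm {g : Fin 3 → E3 → ℂ} (hg : ∀ j, Integrable (g j) volume) :
    Integrable (fun y => ∑ j, ‖g j y‖) volume :=
  integrable_finsetSum _ fun j _ => (hg j).norm

lemma norm_smul_sum_fieldKer_le {t : ℝ} (ht : 0 ≤ t) (g : Fin 3 → E3 → ℂ) (ψ : E3 → ℝ)
    (x y : E3) :
    ‖ψ x • ∑ j, fieldKer t j (x - y) • g j y‖ ≤
      |ψ x| * ((‖x - y‖ ^ 2)⁻¹ * |∑ j, ‖g j y‖|) := by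
  rw [norm_smul, Real.norm_eq_abs, abs_of_nonneg (Finset.sum_nonneg fun j _ => norm_nonneg (g j y))]
  gcongr
  exact norm_sum_fieldKer_smul_le ht g _ _

lemma integrable_prod_fieldKer {t : ℝ} (ht : 0 ≤ t) {g : Fin 3 → E3 → ℂ}
    (hg : ∀ j, Integrable (g j) volume) {ψ : E3 → ℝ} {M : ℝ} (hψ : Integrable ψ volume)
    (hM : ∀ x, |ψ x| ≤ M) :
    Integrable (fun p : E3 × E3 => ψ p.1 • ∑ j, fieldKer t j (p.1 - p.2) • g j p.2)
      (volume.prod volume) :=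
  (integrable_prod_inv_sq hψ hM (integrable_sum_norm hg)).mono'
    (AEStronglyMeasurable.smul (hψ.aestronglyMeasurable.comp_fst)
      (aestronglyMeasurable_prod_fieldKer t fun j => (hg j).aestronglyMeasurable))
    (ae_of_all _ fun p => norm_smul_sum_fieldKer_le ht g ψ p.1 p.2)

lemma integrable_smul_potentialReg {t : ℝ} (ht : 0 ≤ t) {g : Fin 3 → E3 → ℂ}
    (hg : ∀ j, Integrable (g j) volume) {ψ : E3 → ℝ} {M : ℝ} (hψ : Integrable ψ volume)
    (hM : ∀ x, |ψ x| ≤ M) : Integrable (fun x => ψ x • potentialReg t g x) volume := by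
  refine (integrable_prod_fieldKer ht hg hψ hM).integral_prod_left.congr (ae_of_all _ fun x => ?_)
  simp only [potentialReg, integral_smul]

lemma locallyIntegrable_potentialReg {t : ℝ} (ht : 0 ≤ t) {g : Fin 3 → E3 → ℂ}
    (hg : ∀ j, Integrable (g j) volume) : LocallyIntegrable (potentialReg t g) volume := by
  rw [locallyIntegrable_iff]
  intro K hK
  have h1 : Integrable (K.indicator fun _ => (1 : ℝ)) (volume : Measure E3) :=
    (integrable_indicator_iff hK.measurableSet).2
      (integrableOn_const hK.measure_lt_top.ne)
  have h2 := integrable_smul_potentialReg ht hg (M := 1) h1 fun x => by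
    by_cases hx : x ∈ K <;> simp [hx]
  rw [← integrable_indicator_iff hK.measurableSet]
  refine h2.congr (ae_of_all _ fun x => ?_)
  by_cases hx : x ∈ K <;> simp [hx]

/-- The limit is taken on the product space: there the integrands converge pointwise under one
integrable majorant. -/
lemma tendsto_integral_smul_potentialReg {g : Fin 3 → E3 → ℂ}
    (hg : ∀ j, Integrable (g j) volume) {ψ : E3 → ℝ} {M : ℝ} (hψ : Integrable ψ volume)
    (hM : ∀ x, |ψ x| ≤ M) :
    Tendsto (fun c : ℝ => ∫ x, ψ x • potentialReg (c ^ 2)⁻¹ g x) atTop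
      (𝓝 (∫ x, ψ x • potentialReg 0 g x)) := by
  have key : ∀ t : ℝ, 0 ≤ t → ∫ x, ψ x • potentialReg t g x =
      ∫ p : E3 × E3, ψ p.1 • ∑ j, fieldKer t j (p.1 - p.2) • g j p.2 := by
    intro t ht
    erw [integral_prod _ (integrable_prod_fieldKer ht hg hψ hM)]
    simp only [potentialReg, integral_smul]
  rw [key 0 le_rfl]
  simp_rw [key _ (inv_nonneg.2 (sq_nonneg _))]
  refine tendsto_integral_filter_of_dominated_convergence _ ?_ ?_
    (integrable_prod_inv_sq hψ hM (integrable_sum_norm hg)) ?_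
  · exact Eventually.of_forall fun c =>
      (integrable_prod_fieldKer (inv_nonneg.2 (sq_nonneg c)) hg hψ hM).aestronglyMeasurable
  · exact Eventually.of_forall fun c => ae_of_all _ fun p =>
      norm_smul_sum_fieldKer_le (inv_nonneg.2 (sq_nonneg c)) g ψ p.1 p.2
  · refine ae_of_all _ fun p => ?_
    exact Tendsto.const_smul (tendsto_finsetSum _ fun j _ => (tendsto_fieldKer j _).smul_const _) _

/-! ### Convergence of the peaks to a multiple of the Dirac mass -/

lemma integral_peakKer_sub {c : ℝ} (hc : 0 < c) (y : E3) :
    ∫ x, peakKer (c ^ 2)⁻¹ (x - y) = ∫ z, peakKer 1 z := by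
  rw [integral_sub_right_eq_self (fun x => peakKer (c ^ 2)⁻¹ x) y]
  simp_rw [peakKer_inv_sq hc]
  rw [integral_const_mul, Measure.integral_comp_smul_of_nonneg volume (peakKer 1) c (hR := hc.le),
    finrank_euclideanSpace_fin, smul_eq_mul, ← mul_assoc, mul_inv_cancel₀ (by positivity), one_mul]

lemma integrable_peakKer_sub {c : ℝ} (hc : 0 < c) (y : E3) :
    Integrable (fun x => peakKer (c ^ 2)⁻¹ (x - y)) volume := by
  by_contra h
  -- A non-integrable function would have Bochner integral zero, but this integral is positive.
  have := integral_undef h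
  rw [integral_peakKer_sub hc y] at this
  exact integral_peakKer_one_pos.ne' this

lemma peakKer_neg (t : ℝ) (z : E3) : peakKer t (-z) = peakKer t z := by
  simp [peakKer]

lemma tendsto_integral_peakKer_mul {ψ : E3 → ℝ} (hψ : Integrable ψ volume) (hc : Continuous ψ)
    (y : E3) :
    Tendsto (fun c : ℝ => ∫ x, peakKer (c ^ 2)⁻¹ (x - y) * ψ x) atTop
      (𝓝 ((∫ z, peakKer 1 z) * ψ y)) := by
  set I := ∫ z, peakKer 1 z with hI
  have hIpos : 0 < I := integral_peakKer_one_pos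
  have h := tendsto_integral_comp_smul_smul_of_integrable' (μ := (volume : Measure E3))
    (φ := fun z => I⁻¹ * peakKer 1 z) (x₀ := y)
    (fun x => mul_nonneg (inv_nonneg.2 hIpos.le) (peakKer_nonneg zero_le_one x))
    (by rw [integral_const_mul, ← hI, inv_mul_cancel₀ hIpos.ne']) ?_ hψ hc.continuousAt
  · refine (h.const_mul I).congr' ?_
    filter_upwards [eventually_gt_atTop 0] with c hc0
    rw [← integral_const_mul]
    congr 1 with x
    rw [finrank_euclideanSpace_fin, ← neg_sub y x, peakKer_neg, peakKer_inv_sq hc0, smul_eq_mul]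
    field_simp
  · rw [finrank_euclideanSpace_fin]
    have h1 : Tendsto (fun x : E3 => I⁻¹ * (‖x‖ ^ 2)⁻¹) (Bornology.cobounded E3) (𝓝 0) := by
      have := ((tendsto_pow_atTop two_ne_zero).comp
        (tendsto_norm_cobounded_atTop (E := E3))).inv_tendsto_atTop.const_mul I⁻¹
      simpa using this
    refine squeeze_zero (fun x => ?_) (fun x => ?_) h1
    · exact mul_nonneg (by positivity)
        (mul_nonneg (inv_nonneg.2 hIpos.le) (peakKer_nonneg zero_le_one x))
    · rcases eq_or_ne x 0 with rfl | hx
      · simp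
      have hx' : 0 < ‖x‖ := norm_pos_iff.2 hx
      have h2 : peakKer 1 x ≤ (‖x‖ ^ 5)⁻¹ := by
        rw [peakKer, one_mul]
        calc (‖x‖ ^ 2 + 1) ^ (-(5 / 2) : ℝ) ≤ (‖x‖ ^ 2) ^ (-(5 / 2) : ℝ) :=
              Real.rpow_le_rpow_of_nonpos (by positivity) (by linarith) (by norm_num)
          _ = (‖x‖ ^ 5)⁻¹ := by
              rw [← Real.rpow_natCast ‖x‖ 2, ← Real.rpow_mul hx'.le, ← Real.rpow_natCast ‖x‖ 5,
                ← Real.rpow_neg hx'.le]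
              norm_num
      calc ‖x‖ ^ 3 * (I⁻¹ * peakKer 1 x) ≤ ‖x‖ ^ 3 * (I⁻¹ * (‖x‖ ^ 5)⁻¹) := by gcongr
        _ = I⁻¹ * (‖x‖ ^ 2)⁻¹ := by field_simp

/-- Fubini and the symmetric role of the two variables move the peak from U, which is only
integrable, onto the continuous ψ, where the convergence is pointwise. -/
lemma tendsto_integral_smul_peakKer {U : E3 → ℂ} (hU : Integrable U volume) {ψ : E3 → ℝ} {M : ℝ}
    (hψ : Integrable ψ volume) (hc : Continuous ψ) (hM : ∀ x, |ψ x| ≤ M) :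
    Tendsto (fun c : ℝ => ∫ x, ψ x • ∫ y, peakKer (c ^ 2)⁻¹ (x - y) • U y) atTop
      (𝓝 ((∫ z, peakKer 1 z) • ∫ y, ψ y • U y)) := by
  have key : ∀ c : ℝ, 0 < c → ∫ x, ψ x • ∫ y, peakKer (c ^ 2)⁻¹ (x - y) • U y =
      ∫ y, (∫ x, peakKer (c ^ 2)⁻¹ (x - y) * ψ x) • U y := by
    intro c hc0
    have ht : 0 < (c ^ 2)⁻¹ := by positivity
    have hint : Integrable (fun p : E3 × E3 => ψ p.1 • peakKer (c ^ 2)⁻¹ (p.1 - p.2) • U p.2)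
        (volume.prod volume) := by
      refine ((hψ.smul_prod hU).norm.const_mul
        ((c ^ 2)⁻¹ * ((c ^ 2)⁻¹) ^ (-(5 / 2) : ℝ))).mono' ?_ (ae_of_all _ fun p => ?_)
      · refine (hψ.aestronglyMeasurable.comp_fst).smul
          (AEStronglyMeasurable.smul (f := fun p : E3 × E3 => peakKer (c ^ 2)⁻¹ (p.1 - p.2)) ?_
            (hU.aestronglyMeasurable.comp_snd))
        exact Measurable.aestronglyMeasurable (by fun_prop)
      · rw [smul_comm, norm_smul, Real.norm_of_nonneg (peakKer_nonneg ht.le _)]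
        gcongr
        exact peakKer_le ht _
    calc ∫ x, ψ x • ∫ y, peakKer (c ^ 2)⁻¹ (x - y) • U y
        = ∫ x, ∫ y, ψ x • peakKer (c ^ 2)⁻¹ (x - y) • U y := by simp_rw [integral_smul]
      _ = ∫ y, ∫ x, ψ x • peakKer (c ^ 2)⁻¹ (x - y) • U y := integral_integral_swap hint
      _ = _ := by
        congr 1 with y
        rw [← integral_smul_const]
        congr 1 with x
        rw [mul_smul, smul_comm]
  have h : Tendsto (fun c : ℝ => ∫ y, (∫ x, peakKer (c ^ 2)⁻¹ (x - y) * ψ x) • U y) atTop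
      (𝓝 (∫ y, ((∫ z, peakKer 1 z) * ψ y) • U y)) := by
    refine tendsto_integral_filter_of_dominated_convergence
      (fun y => (M * ∫ z, peakKer 1 z) * ‖U y‖) ?_ ?_ (hU.norm.const_mul _) ?_
    · refine Eventually.of_forall fun c => AEStronglyMeasurable.smul
        (f := fun y => ∫ x, peakKer (c ^ 2)⁻¹ (x - y) * ψ x) ?_ hU.aestronglyMeasurable
      refine AEStronglyMeasurable.integral_prod_right' (μ := volume) (ν := volume)
        (f := fun p : E3 × E3 => peakKer (c ^ 2)⁻¹ (p.2 - p.1) * ψ p.2) ?_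
      refine AEStronglyMeasurable.mul ?_ (hψ.aestronglyMeasurable.comp_snd)
      exact Measurable.aestronglyMeasurable (by fun_prop)
    · filter_upwards [eventually_gt_atTop 0] with c hc0
      refine ae_of_all _ fun y => ?_
      rw [norm_smul]
      gcongr
      rw [mul_comm M, ← integral_peakKer_sub hc0 y, ← integral_mul_const]
      refine norm_integral_le_of_norm_le ((integrable_peakKer_sub hc0 y).mul_const M)
        (ae_of_all _ fun x => ?_)
      have := peakKer_nonneg (t := (c ^ 2)⁻¹) (by positivity) (x - y)
      rw [norm_mul, Real.norm_of_nonneg this]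
      gcongr
      exact hM x
    · exact ae_of_all _ fun y => (tendsto_integral_peakKer_mul hψ hc y).smul_const _
  rw [← integral_smul]
  simp_rw [← mul_smul]
  refine h.congr' ?_
  filter_upwards [eventually_gt_atTop 0] with c hc0 using (key c hc0).symm

/-- If the mollifications of `U` are the regularised potentials of `g`, then `U` is a multiple of
the potential of `g`. -/
theorem ae_eq_potential {U : E3 → ℂ} {g : Fin 3 → E3 → ℂ} (hU : Integrable U volume)
    (hg : ∀ j, Integrable (g j) volume)
    (h : ∀ t > 0, ∀ x, ∫ y, (3 * peakKer t (x - y)) • U y = potentialReg t g x) :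
    ∀ᵐ x, U x = (3 * ∫ z, peakKer 1 z)⁻¹ • potentialReg 0 g x := by
  have hI := integral_peakKer_one_pos
  have hI0 : (3 * ∫ z, peakKer 1 z) ≠ 0 := by positivity
  -- Both sides are compared as distributions, since the limit t → 0 has only been established after
  -- integration against test functions.
  refine ae_eq_of_integral_contDiff_smul_eq hU.locallyIntegrable
    (LocallyIntegrable.smul (f := potentialReg 0 g) (locallyIntegrable_potentialReg le_rfl hg)
      (3 * ∫ z, peakKer 1 z)⁻¹) fun ψ hψ hψs => ?_
  have hψi := hψ.continuous.integrable_of_hasCompactSupport (μ := volume) hψs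
  obtain ⟨M, hM⟩ := hψs.exists_bound_of_continuous hψ.continuous
  have h1 := (tendsto_integral_smul_peakKer hU hψi hψ.continuous hM).const_smul (3 : ℝ)
  have h2 := tendsto_integral_smul_potentialReg hg hψi hM
  have h3 : (3 : ℝ) • ((∫ z, peakKer 1 z) • ∫ y, ψ y • U y) = ∫ x, ψ x • potentialReg 0 g x := by
    refine tendsto_nhds_unique (h1.congr' ?_) h2
    filter_upwards [eventually_gt_atTop 0] with c hc0
    rw [← integral_smul]
    congr 1 with x
    rw [← h _ (inv_pos.2 (pow_pos hc0 2)) x]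
    simp_rw [mul_smul]
    rw [integral_smul, smul_comm]
  simp_rw [smul_comm (ψ _) (3 * ∫ z, peakKer 1 z)⁻¹, integral_smul]
  rw [← h3, smul_smul 3, inv_smul_smul₀ hI0]

/-! ### Integrability of potentials -/

/-- Finiteness in Young's convolution inequality. -/
theorem lintegral_rpow_convolution_lt_top {E : Type*} [MeasurableSpace E] [AddCommGroup E]
    [MeasurableAdd₂ E] [MeasurableNeg E] {μ : Measure E} [SFinite μ] [μ.IsAddLeftInvariant]
    [μ.IsNegInvariant] {K f : E → ℝ≥0∞} (hK : Measurable K) (hf : AEMeasurable f μ) {a p r : ℝ}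
    (ha : 1 < a) (hp : 1 < p) (hpr : p < r) (hapr : a⁻¹ + p⁻¹ = 1 + r⁻¹)
    (hKa : ∫⁻ z, K z ^ a ∂μ < ⊤) (hfp : ∫⁻ y, f y ^ p ∂μ < ⊤) :
    ∫⁻ x, (∫⁻ y, K (x - y) * f y ∂μ) ^ r ∂μ < ⊤ := by
  have hr : 0 < r := by linarith
  have ha0 : 0 < a := by linarith
  have hp0 : 0 < p := by linarith
  set NK := ∫⁻ z, K z ^ a ∂μ with hNK
  set Nf := ∫⁻ y, f y ^ p ∂μ with hNf
  have hw2 : 0 ≤ p⁻¹ - r⁻¹ := by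
    rw [sub_nonneg]; gcongr
  have hw3 : 0 ≤ a⁻¹ - r⁻¹ := by
    have : p⁻¹ < 1 := inv_lt_one_of_one_lt₀ hp
    linarith
  have hKx : ∀ x, Measurable fun y => K (x - y) := fun x => by
    simp_rw [sub_eq_add_neg]; fun_prop
  have hKN : ∀ x, ∫⁻ y, K (x - y) ^ a ∂μ = NK := fun x =>
    lintegral_sub_left_eq_self (fun z => K z ^ a) x
  have hpt : ∀ x, (∫⁻ y, K (x - y) * f y ∂μ) ≤
      (∫⁻ y, K (x - y) ^ a * f y ^ p ∂μ) ^ r⁻¹ * (Nf ^ (p⁻¹ - r⁻¹) * NK ^ (a⁻¹ - r⁻¹)) := by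
    intro x
    have hm1 : AEMeasurable (fun y => K (x - y) ^ a) μ := ((hKx x).pow_const a).aemeasurable
    have hm2 : AEMeasurable (fun y => f y ^ p) μ := hf.pow_const p
    -- Three-factor Hölder: K f = (K^a f^p)^(1/r) · (f^p)^(1/p - 1/r) · (K^a)^(1/a - 1/r), the
    -- weights summing to 1 by the relation between the exponents.
    have := ENNReal.lintegral_mul_prod_norm_pow_le (μ := μ) Finset.univ
      (g := fun y => K (x - y) ^ a * f y ^ p)
      (f := ![fun y => f y ^ p, fun y => K (x - y) ^ a]) (hm1.mul hm2)
      (by intro i _; fin_cases i; exacts [hm2, hm1]) r⁻¹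
      (p := ![p⁻¹ - r⁻¹, a⁻¹ - r⁻¹])
      (by simp only [Fin.sum_univ_two, Matrix.cons_val_zero, Matrix.cons_val_one]; linarith)
      (by positivity) (by intro i _; fin_cases i; exacts [hw2, hw3])
    simp only [Fin.prod_univ_two, Matrix.cons_val_zero, Matrix.cons_val_one] at this
    rw [hKN, ← hNf] at this
    refine le_trans (le_of_eq (lintegral_congr fun y => ?_)) this
    rw [ENNReal.mul_rpow_of_nonneg _ _ (inv_nonneg.2 hr.le), ← ENNReal.rpow_mul,
      ← ENNReal.rpow_mul, ← ENNReal.rpow_mul, ← ENNReal.rpow_mul]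
    calc K (x - y) * f y = K (x - y) ^ (a * r⁻¹ + a * (a⁻¹ - r⁻¹)) *
          f y ^ (p * r⁻¹ + p * (p⁻¹ - r⁻¹)) := by
          rw [← mul_add, ← mul_add, add_sub_cancel, add_sub_cancel, mul_inv_cancel₀ ha0.ne',
            mul_inv_cancel₀ hp0.ne', ENNReal.rpow_one, ENNReal.rpow_one]
      _ = _ := by
          rw [ENNReal.rpow_add_of_nonneg _ _ (by positivity) (by positivity),
            ENNReal.rpow_add_of_nonneg _ _ (by positivity) (by positivity)]
          ring
  set C := Nf ^ (p⁻¹ - r⁻¹) * NK ^ (a⁻¹ - r⁻¹) with hC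
  have hCtop : C ^ r ≠ ⊤ := by
    refine ENNReal.rpow_ne_top_of_nonneg hr.le (ENNReal.mul_ne_top ?_ ?_)
    · exact ENNReal.rpow_ne_top_of_nonneg hw2 hfp.ne
    · exact ENNReal.rpow_ne_top_of_nonneg hw3 hKa.ne
  calc ∫⁻ x, (∫⁻ y, K (x - y) * f y ∂μ) ^ r ∂μ
      ≤ ∫⁻ x, (∫⁻ y, K (x - y) ^ a * f y ^ p ∂μ) * C ^ r ∂μ := by
        refine lintegral_mono fun x => ?_
        refine (ENNReal.rpow_le_rpow (hpt x) hr.le).trans_eq ?_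
        rw [ENNReal.mul_rpow_of_nonneg _ _ hr.le, ENNReal.rpow_inv_rpow hr.ne']
    _ = (∫⁻ x, ∫⁻ y, K (x - y) ^ a * f y ^ p ∂μ ∂μ) * C ^ r := lintegral_mul_const' _ _ hCtop
    _ = (∫⁻ y, ∫⁻ x, K (x - y) ^ a * f y ^ p ∂μ ∂μ) * C ^ r := by
        rw [lintegral_lintegral_swap]
        refine AEMeasurable.mul ?_ ((hf.pow_const p).comp_snd)
        refine Measurable.aemeasurable ((hK.comp ?_).pow_const a)
        simp_rw [sub_eq_add_neg]; fun_prop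
    _ = NK * Nf * C ^ r := by
        congr 1
        rw [hNf, ← lintegral_const_mul'' _ (hf.pow_const p)]
        refine lintegral_congr fun y => ?_
        rw [lintegral_mul_const]
        · congr 1
          exact lintegral_sub_right_eq_self (fun z => K z ^ a) y
        · refine (hK.comp ?_).pow_const a
          simp_rw [sub_eq_add_neg]; fun_prop
    _ < ⊤ := ENNReal.mul_lt_top (ENNReal.mul_lt_top hKa hfp) hCtop.lt_top

lemma lintegral_rpow_enorm_lt_top {α F : Type*} [MeasurableSpace α] [NormedAddCommGroup F]
    {μ : Measure α} {f : α → F} {p : ℝ} (hp : 0 < p) (hf : MemLp f (ENNReal.ofReal p) μ) :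
    ∫⁻ x, ‖f x‖ₑ ^ p ∂μ < ⊤ := by
  have := (eLpNorm_lt_top_iff_lintegral_rpow_enorm_lt_top (by simpa using hp)
    ENNReal.ofReal_ne_top).1 hf.2
  rwa [ENNReal.toReal_ofReal hp.le] at this

/-- The potential of a compactly supported `L_p` density is locally in `L_r`. -/
theorem memLp_potentialReg_restrict_ball {p r : ℝ} (hp : 1 < p) (hpr : p < r)
    (hrp : p⁻¹ - 1 / 3 < r⁻¹) {g : Fin 3 → E3 → ℂ} (hg : ∀ j, Integrable (g j) volume)
    (hgp : ∀ j, MemLp (g j) (ENNReal.ofReal p) volume) {c : E3} {R : ℝ}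
    (hsupp : ∀ j y, y ∉ closedBall c R → g j y = 0) :
    MemLp (potentialReg 0 g) (ENNReal.ofReal r) (volume.restrict (closedBall c R)) := by
  have hr : 0 < r := by linarith
  -- b is 1/a for the kernel exponent a in Young's inequality; `hrp` says precisely that a < 3/2.
  set b : ℝ := 1 + r⁻¹ - p⁻¹ with hb
  have hb1 : b < 1 := by
    have : r⁻¹ < p⁻¹ := by gcongr
    linarith
  have hb2 : 2 / 3 < b := by linarith
  have ha : 1 < b⁻¹ := (one_lt_inv₀ (by linarith)).2 hb1
  have ha' : b⁻¹ < 3 / 2 := by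
    rw [inv_lt_comm₀ (by linarith) (by norm_num)]; linarith
  set G : E3 → ℝ := fun y => ∑ j, ‖g j y‖ with hG
  have hGp : MemLp G (ENNReal.ofReal p) volume := memLp_finsetSum _ fun j _ => (hgp j).norm
  refine ⟨(locallyIntegrable_potentialReg le_rfl hg).aestronglyMeasurable.restrict, ?_⟩
  rw [eLpNorm_lt_top_iff_lintegral_rpow_enorm_lt_top (by simpa using hr) ENNReal.ofReal_ne_top,
    ENNReal.toReal_ofReal hr.le]
  have hY := lintegral_rpow_convolution_lt_top (μ := (volume : Measure E3))
    -- For x and y in the closed ball of radius R the difference has norm at most 2R, so the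
    -- truncation is invisible.
    (K := fun z => ‖nearKer (2 * R + 1) z‖ₑ) (f := fun y => ‖G y‖ₑ)
    (measurable_nearKer _).enorm hGp.1.aemeasurable.enorm ha hp hpr
    (by rw [inv_inv]; ring) (lintegral_rpow_enorm_lt_top (by linarith)
      (memLp_nearKer _ (by linarith) ha')) (lintegral_rpow_enorm_lt_top (by linarith) hGp)
  refine lt_of_le_of_lt ?_ hY
  refine le_trans ?_ (setLIntegral_le_lintegral (closedBall c R) _)
  refine setLIntegral_mono' measurableSet_closedBall fun x hx => ?_
  refine ENNReal.rpow_le_rpow ?_ hr.le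
  refine (enorm_integral_le_lintegral_enorm _).trans (lintegral_mono fun y => ?_)
  by_cases hy : y ∈ closedBall c R
  · have hxy : x - y ∈ ball (0 : E3) (2 * R + 1) := by
      rw [mem_ball_zero_iff, ← dist_eq_norm]
      have := dist_triangle_right x y c
      have h1 := mem_closedBall.1 hx
      have h2 := mem_closedBall.1 hy
      linarith
    rw [← enorm_mul]
    refine enorm_le_iff_norm_le.2 ((norm_sum_fieldKer_smul_le le_rfl g x y).trans ?_)
    rw [norm_mul, Real.norm_of_nonneg (nearKer_nonneg _ _), nearKer, indicator_of_mem hxy]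
    gcongr
    exact le_abs_self _
  · simp [hsupp _ y hy]

/-! ### Hölder continuity of potentials -/

lemma fieldKer_zero_smul {ρ : ℝ} (hρ : 0 < ρ) (j : Fin 3) (z : E3) :
    fieldKer 0 j (ρ • z) = (ρ ^ 2)⁻¹ * fieldKer 0 j z := by
  rw [fieldKer_zero, fieldKer_zero, norm_smul, Real.norm_of_nonneg hρ.le, PiLp.smul_apply,
    smul_eq_mul]
  field_simp

/-- Away from the origin the gradient of the kernel decays like |z|⁻³. Here b ≥ 1 and a ≤ b + 1 ≤
2b, so (a² + ab + b²)/b² ≤ 7 and the constant 20 leaves room. -/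
lemma abs_fieldKer_sub_le_of_far {z e : E3} (he : ‖e‖ = 1) (hz : 2 ≤ ‖z‖) (j : Fin 3) :
    |fieldKer 0 j z - fieldKer 0 j (z - e)| ≤ 20 * (‖z‖ ^ 3)⁻¹ := by
  rw [fieldKer_zero, fieldKer_zero]
  set a := ‖z‖ with ha
  set b := ‖z - e‖ with hb
  have hab : |a - b| ≤ 1 := by
    have := abs_norm_sub_norm_le z (z - e)
    rwa [sub_sub_cancel, he] at this
  obtain ⟨h1, h2⟩ := abs_le.1 hab
  have ha0 : 0 < a := by linarith
  have hb0 : 0 < b := by linarith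
  have hz1 : |z j - (z - e) j| ≤ 1 := by
    rw [PiLp.sub_apply, sub_sub_cancel, ← he]; exact abs_coord_le e j
  have hz2 : |(z - e) j| ≤ b := abs_coord_le _ _
  have h3 : |(a ^ 3)⁻¹ - (b ^ 3)⁻¹| ≤ (a ^ 2 + a * b + b ^ 2) * ((a ^ 3)⁻¹ * (b ^ 3)⁻¹) := by
    have : (a ^ 3)⁻¹ - (b ^ 3)⁻¹ =
        -((a - b) * ((a ^ 2 + a * b + b ^ 2) * ((a ^ 3)⁻¹ * (b ^ 3)⁻¹))) := by
      field_simp; ring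
    rw [this, abs_neg, abs_mul, abs_of_pos (a := (a ^ 2 + a * b + b ^ 2) * _) (by positivity)]
    exact mul_le_of_le_one_left (by positivity) hab
  have h4 : b * ((a ^ 2 + a * b + b ^ 2) * ((a ^ 3)⁻¹ * (b ^ 3)⁻¹)) ≤ 19 * (a ^ 3)⁻¹ := by
    have : b * ((a ^ 2 + a * b + b ^ 2) * ((a ^ 3)⁻¹ * (b ^ 3)⁻¹)) =
        ((a ^ 2 + a * b + b ^ 2) / b ^ 2) * (a ^ 3)⁻¹ := by
      field_simp
    rw [this]
    gcongr
    rw [div_le_iff₀ (by positivity)]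
    nlinarith
  calc |z j * (a ^ 3)⁻¹ - (z - e) j * (b ^ 3)⁻¹|
      = |(z j - (z - e) j) * (a ^ 3)⁻¹ + (z - e) j * ((a ^ 3)⁻¹ - (b ^ 3)⁻¹)| := by
        congr 1; ring
    _ ≤ |z j - (z - e) j| * (a ^ 3)⁻¹ + |(z - e) j| * |(a ^ 3)⁻¹ - (b ^ 3)⁻¹| := by
        refine (abs_add_le _ _).trans_eq ?_
        rw [abs_mul, abs_mul, abs_of_pos (a := (a ^ 3)⁻¹) (by positivity)]
    _ ≤ 1 * (a ^ 3)⁻¹ + b * ((a ^ 2 + a * b + b ^ 2) * ((a ^ 3)⁻¹ * (b ^ 3)⁻¹)) := by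
        gcongr
    _ ≤ 20 * (a ^ 3)⁻¹ := by linarith

lemma abs_fieldKer_sub_le {e : E3} (he : ‖e‖ = 1) (j : Fin 3) (z : E3) :
    |fieldKer 0 j z - fieldKer 0 j (z - e)| ≤
      nearKer 3 z + nearKer 3 (z - e) + 20 * farKer 2 z := by
  by_cases hz : z ∈ ball (0 : E3) 2
  · have hz' : ‖z‖ < 2 := by simpa using hz
    have h1 : z ∈ ball (0 : E3) 3 := by rw [mem_ball_zero_iff]; linarith
    have h2 : z - e ∈ ball (0 : E3) 3 := by
      rw [mem_ball_zero_iff]; linarith [norm_sub_le z e]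
    have h5 : nearKer 3 z = (‖z‖ ^ 2)⁻¹ := indicator_of_mem h1 _
    have h6 : nearKer 3 (z - e) = (‖z - e‖ ^ 2)⁻¹ := indicator_of_mem h2 _
    rw [h5, h6]
    have := farKer_nonneg 2 z
    refine (abs_sub _ _).trans ?_
    have h3 := abs_fieldKer_le le_rfl j z
    have h4 := abs_fieldKer_le le_rfl j (z - e)
    linarith
  · have hz' : 2 ≤ ‖z‖ := by simpa using hz
    have := abs_fieldKer_sub_le_of_far he hz' j
    have h1 := nearKer_nonneg 3 z
    have h2 := nearKer_nonneg 3 (z - e)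
    rw [farKer, indicator_of_mem (by exact hz)]
    linarith

lemma eLpNorm_comp_inv_smul {f : E3 → ℝ} (hf : Measurable f) {ρ : ℝ} (hρ : 0 < ρ) {s : ℝ}
    (hs : 0 < s) :
    eLpNorm (fun z => f (ρ⁻¹ • z)) (ENNReal.ofReal s) volume =
      ENNReal.ofReal (ρ ^ (3 / s)) * eLpNorm f (ENNReal.ofReal s) volume := by
  have h := Measure.map_addHaar_smul (volume : Measure E3) (inv_ne_zero hρ.ne')
  rw [finrank_euclideanSpace_fin] at h
  have h2 := eLpNorm_map_measure (μ := (volume : Measure E3)) (f := fun z : E3 => ρ⁻¹ • z)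
    (p := ENNReal.ofReal s) hf.aestronglyMeasurable (by fun_prop)
  have h3 : (fun z => f (ρ⁻¹ • z)) = f ∘ fun z : E3 => ρ⁻¹ • z := rfl
  rw [h3, ← h2, h, eLpNorm_smul_measure_of_ne_top ENNReal.ofReal_ne_top, smul_eq_mul]
  congr 1
  rw [one_div, ENNReal.toReal_inv, ENNReal.toReal_ofReal hs.le,
    ENNReal.ofReal_rpow_of_nonneg (abs_nonneg _) (by positivity), inv_pow, inv_inv,
    abs_of_pos (by positivity), ← Real.rpow_natCast ρ 3, ← Real.rpow_mul hρ.le]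
  norm_num [div_eq_mul_inv]

/-- Modulus of continuity of the Cauchy kernel in `L_s`. -/
lemma exists_eLpNorm_fieldKer_sub_le {s : ℝ} (hs : 1 < s) (hs' : s < 3 / 2) :
    ∃ C : ℝ≥0, ∀ (j : Fin 3) (h : E3),
      eLpNorm (fun z => fieldKer 0 j z - fieldKer 0 j (z - h)) (ENNReal.ofReal s) volume ≤
        C * ENNReal.ofReal (‖h‖ ^ (3 / s - 2)) := by
  have hs0 : 0 < s := by linarith
  have hs1 : 1 ≤ ENNReal.ofReal s := by
    rw [← ENNReal.ofReal_one]; exact ENNReal.ofReal_le_ofReal hs.le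
  have hn := memLp_nearKer 3 hs0 hs'
  have hf := memLp_farKer (R := 2) two_pos hs
  have hsum : MemLp (fun z => nearKer 3 z + 20 * farKer 2 z) (ENNReal.ofReal s) volume :=
    hn.add (hf.const_mul 20)
  set C0 := eLpNorm (fun z => nearKer 3 z + 20 * farKer 2 z) (ENNReal.ofReal s) volume +
    eLpNorm (nearKer 3) (ENNReal.ofReal s) volume with hC0
  have hC0top : C0 ≠ ⊤ := ENNReal.add_ne_top.2 ⟨hsum.2.ne, hn.2.ne⟩
  -- The kernel is homogeneous of degree -2, so a dilation reduces the estimate to shifts of length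
  -- one.
  have hunit : ∀ (j : Fin 3) (e : E3), ‖e‖ = 1 →
      eLpNorm (fun z => fieldKer 0 j z - fieldKer 0 j (z - e)) (ENNReal.ofReal s) volume ≤ C0 := by
    intro j e he
    have h1 : eLpNorm (fun z => nearKer 3 (z - e)) (ENNReal.ofReal s) volume =
        eLpNorm (nearKer 3) (ENNReal.ofReal s) volume :=
      eLpNorm_comp_measurePreserving (measurable_nearKer 3).aestronglyMeasurable
        (measurePreserving_sub_right volume e)
    have h2 : Measurable fun z => nearKer 3 (z - e) :=
      (measurable_nearKer 3).comp (measurable_id.sub_const e)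
    rw [hC0, ← h1]
    refine le_trans ?_ (eLpNorm_add_le hsum.1 h2.aestronglyMeasurable hs1)
    refine eLpNorm_mono_real fun z => ?_
    have := abs_fieldKer_sub_le he j z
    rw [Real.norm_eq_abs, Pi.add_apply]
    linarith
  refine ⟨C0.toNNReal, fun j h => ?_⟩
  rw [ENNReal.coe_toNNReal hC0top]
  rcases eq_or_ne h 0 with rfl | hh
  · simp
  have hρ : 0 < ‖h‖ := norm_pos_iff.2 hh
  set ρ := ‖h‖ with hρd
  set e := ρ⁻¹ • h with hed
  have he : ‖e‖ = 1 := by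
    rw [hed, norm_smul, norm_inv, Real.norm_of_nonneg hρ.le, ← hρd, inv_mul_cancel₀ hρ.ne']
  have hscale : (fun z => fieldKer 0 j z - fieldKer 0 j (z - h)) =
      fun z => (ρ ^ 2)⁻¹ * (fun z => fieldKer 0 j z - fieldKer 0 j (z - e)) (ρ⁻¹ • z) := by
    ext z
    have h1 : z = ρ • ρ⁻¹ • z := (smul_inv_smul₀ hρ.ne' z).symm
    have h2 : z - h = ρ • (ρ⁻¹ • z - e) := by
      rw [hed, ← smul_sub, smul_inv_smul₀ hρ.ne']
    rw [h2]
    conv_lhs => rw [h1]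
    rw [fieldKer_zero_smul hρ, smul_inv_smul₀ hρ.ne', fieldKer_zero_smul hρ]
    ring
  have hmul := eLpNorm_const_smul (c := (ρ ^ 2)⁻¹) (p := ENNReal.ofReal s)
    (μ := (volume : Measure E3))
    (f := fun z => (fun z => fieldKer 0 j z - fieldKer 0 j (z - e)) (ρ⁻¹ • z))
  have heq : (fun z => (ρ ^ 2)⁻¹ * (fun z => fieldKer 0 j z - fieldKer 0 j (z - e)) (ρ⁻¹ • z)) =
      (ρ ^ 2)⁻¹ • fun z => (fun z => fieldKer 0 j z - fieldKer 0 j (z - e)) (ρ⁻¹ • z) := rfl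
  rw [hscale, heq, hmul, eLpNorm_comp_inv_smul (f := fun z => fieldKer 0 j z - fieldKer 0 j (z - e))
    (by fun_prop) hρ hs0, ← mul_assoc]
  have hcoef : ‖(ρ ^ 2)⁻¹‖ₑ * ENNReal.ofReal (ρ ^ (3 / s)) =
      ENNReal.ofReal (ρ ^ (3 / s - 2)) := by
    rw [← ofReal_norm, Real.norm_of_nonneg (by positivity),
      ← ENNReal.ofReal_mul (by positivity), Real.rpow_sub hρ, Real.rpow_two]
    congr 1; field_simp
  rw [hcoef, mul_comm]
  gcongr
  exact hunit j e he

lemma integrable_fieldKer_smul {s r : ℝ} (hsr : s.HolderConjugate r) (hs' : s < 3 / 2)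
    {g : E3 → ℂ} (hg : Integrable g volume) (hgr : MemLp g (ENNReal.ofReal r) volume)
    (j : Fin 3) (x : E3) : Integrable (fun y => fieldKer 0 j (x - y) • g y) volume := by
  have := hsr.ennrealOfReal
  have h1 : MemLp (fun y => nearKer 1 (x - y)) (ENNReal.ofReal s) volume :=
    (memLp_nearKer 1 hsr.pos hs').comp_measurePreserving (Measure.measurePreserving_sub_left volume x)
  have h2 : Integrable (fun y => nearKer 1 (x - y) * ‖g y‖) volume :=
    h1.integrable_mul hgr.norm
  refine (h2.add hg.norm).mono' ?_ (ae_of_all _ fun y => ?_)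
  · have : Measurable fun y => fieldKer 0 j (x - y) := by fun_prop
    exact this.aestronglyMeasurable.smul hg.1
  · rw [norm_smul, Real.norm_eq_abs, Pi.add_apply]
    calc |fieldKer 0 j (x - y)| * ‖g y‖ ≤ (nearKer 1 (x - y) + 1) * ‖g y‖ := by
          gcongr
          exact (abs_fieldKer_le le_rfl j _).trans (inv_sq_le_nearKer_add_one _)
      _ = _ := by ring

/-- The potential of an `L_r` density, `r > 3`, is Hölder continuous with exponent `1 - 3 / r`. -/
theorem exists_holderWith_potentialReg {r : ℝ} (hr : 3 < r) {g : Fin 3 → E3 → ℂ}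
    (hg : ∀ j, Integrable (g j) volume) (hgr : ∀ j, MemLp (g j) (ENNReal.ofReal r) volume) :
    ∃ C : ℝ≥0, HolderWith C (1 - 3 / r).toNNReal (potentialReg 0 g) := by
  have hr0 : 0 < r := by linarith
  set s := Real.conjExponent r with hs
  have hrs : r.HolderConjugate s := Real.HolderConjugate.conjExponent (by linarith)
  have hsr := hrs.symm
  have hs1 : 1 < s := hsr.lt
  have hinv : s⁻¹ = 1 - r⁻¹ := by linarith [hrs.inv_add_inv_eq_one]
  have hr3 : r⁻¹ < 1 / 3 := by rw [inv_lt_comm₀ hr0 (by norm_num)]; linarith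
  have hs' : s < 3 / 2 := by
    rw [← inv_inv s, inv_lt_comm₀ (inv_pos.2 hsr.pos) (by norm_num), hinv]; linarith
  have hexp : 3 / s - 2 = 1 - 3 / r := by
    rw [div_eq_mul_inv, hinv, div_eq_mul_inv]; ring
  have hε : 0 ≤ 1 - 3 / r := by
    rw [div_eq_mul_inv]; linarith
  obtain ⟨C, hC⟩ := exists_eLpNorm_fieldKer_sub_le hs1 hs'
  set N := ∑ j, eLpNorm (g j) (ENNReal.ofReal r) volume with hN
  have hNtop : N ≠ ⊤ := ENNReal.sum_ne_top.2 fun j _ => (hgr j).2.ne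
  refine ⟨C * N.toNNReal, fun x x' => ?_⟩
  have hint : ∀ x, Integrable (fun y => ∑ j, fieldKer 0 j (x - y) • g j y) volume := fun x =>
    integrable_finsetSum _ fun j _ => integrable_fieldKer_smul hsr hs' (hg j) (hgr j) j x
  have hj : ∀ j, ∫⁻ y, ‖(fieldKer 0 j (x - y) - fieldKer 0 j (x' - y)) • g j y‖ₑ ≤
      C * ENNReal.ofReal (‖x - x'‖ ^ (3 / s - 2)) * eLpNorm (g j) (ENNReal.ofReal r) volume := by
    intro j
    have := hsr.ennrealOfReal
    have hm : Measurable fun y => fieldKer 0 j (x - y) - fieldKer 0 j (x' - y) := by fun_prop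
    have h1 := eLpNorm_smul_le_mul_eLpNorm (p := ENNReal.ofReal s) (q := ENNReal.ofReal r) (r := 1)
      (hgr j).1 hm.aestronglyMeasurable
    rw [eLpNorm_one_eq_lintegral_enorm] at h1
    refine h1.trans ?_
    gcongr
    refine le_trans (le_of_eq ?_) (hC j (x - x'))
    rw [← eLpNorm_comp_measurePreserving
      (g := fun z => fieldKer 0 j z - fieldKer 0 j (z - (x - x'))) (by
        have : Measurable fun z => fieldKer 0 j z - fieldKer 0 j (z - (x - x')) := by fun_prop
        exact this.aestronglyMeasurable) (Measure.measurePreserving_sub_left volume x)]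
    congr 1
    ext y
    simp only [Function.comp]
    congr 2
    abel
  rw [edist_eq_enorm_sub, potentialReg, potentialReg, ← integral_sub (hint x) (hint x')]
  refine (enorm_integral_le_lintegral_enorm _).trans ?_
  calc ∫⁻ y, ‖∑ j, fieldKer 0 j (x - y) • g j y - ∑ j, fieldKer 0 j (x' - y) • g j y‖ₑ
      ≤ ∫⁻ y, ∑ j, ‖(fieldKer 0 j (x - y) - fieldKer 0 j (x' - y)) • g j y‖ₑ := by
        refine lintegral_mono fun y => ?_
        rw [← Finset.sum_sub_distrib]
        simp_rw [← sub_smul]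
        exact enorm_sum_le _ _
    _ = ∑ j, ∫⁻ y, ‖(fieldKer 0 j (x - y) - fieldKer 0 j (x' - y)) • g j y‖ₑ := by
        refine lintegral_finsetSum' _ fun j _ => ?_
        have hm : Measurable fun y => fieldKer 0 j (x - y) - fieldKer 0 j (x' - y) := by fun_prop
        exact (hm.aestronglyMeasurable.smul (hg j).1).enorm
    _ ≤ ∑ j, C * ENNReal.ofReal (‖x - x'‖ ^ (3 / s - 2)) *
          eLpNorm (g j) (ENNReal.ofReal r) volume := Finset.sum_le_sum fun j _ => hj j
    _ = _ := by
        rw [← Finset.mul_sum, ← hN, hexp, ENNReal.coe_mul, ENNReal.coe_toNNReal hNtop,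
          Real.coe_toNNReal _ hε, edist_eq_enorm_sub, ← ofReal_norm,
          ENNReal.ofReal_rpow_of_nonneg (norm_nonneg _) hε]
        ring

/-! ### Componentwise calculus of biquaternions -/

lemma comp_add (k : Fin 4) (a b : HC) : comp k (a + b) = comp k a + comp k b := by
  fin_cases k <;> simp [comp]

lemma comp_sub (k : Fin 4) (a b : HC) : comp k (a - b) = comp k a - comp k b := by
  fin_cases k <;> simp [comp]

lemma comp_smul (k : Fin 4) (c : ℂ) (a : HC) : comp k (c • a) = c * comp k a := by
  fin_cases k <;> simp [comp]

lemma comp_sum {ι : Type*} (s : Finset ι) (k : Fin 4) (f : ι → HC) :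
    comp k (∑ i ∈ s, f i) = ∑ i ∈ s, comp k (f i) :=
  map_sum (AddMonoidHom.mk' (comp k) (comp_add k)) f s

lemma comp_mul_zero (a b : HC) : comp 0 (a * b) =
    comp 0 a * comp 0 b - comp 1 a * comp 1 b - comp 2 a * comp 2 b - comp 3 a * comp 3 b := by
  simp [comp]; ring

lemma comp_mul_one (a b : HC) : comp 1 (a * b) =
    comp 0 a * comp 1 b + comp 1 a * comp 0 b + comp 2 a * comp 3 b - comp 3 a * comp 2 b := by
  simp [comp]; ring

lemma comp_mul_two (a b : HC) : comp 2 (a * b) =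
    comp 0 a * comp 2 b - comp 1 a * comp 3 b + comp 2 a * comp 0 b + comp 3 a * comp 1 b := by
  simp [comp]; ring

lemma comp_mul_three (a b : HC) : comp 3 (a * b) =
    comp 0 a * comp 3 b + comp 1 a * comp 2 b - comp 2 a * comp 1 b + comp 3 a * comp 0 b := by
  simp [comp]

lemma comp_star (k : Fin 4) (a : HC) : comp k (star a) = if k = 0 then comp k a else -comp k a := by
  fin_cases k <;> simp [comp]

lemma comp_integralOn (k : Fin 4) (G : Set E3) (u : E3 → HC) :
    comp k (integralOn G u) = ∫ x in G, comp k (u x) := by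
  fin_cases k <;> rfl

lemma MemLpOn.mono_set {G B : Set E3} {s : ℝ≥0∞} {u : E3 → HC} (hu : MemLpOn G s u)
    (h : B ⊆ G) : MemLpOn B s u := fun k => (hu k).mono_measure (Measure.restrict_mono h le_rfl)

lemma MemLpOn.add {B : Set E3} {s : ℝ≥0∞} {u v : E3 → HC} (hu : MemLpOn B s u)
    (hv : MemLpOn B s v) : MemLpOn B s (fun x => u x + v x) := fun k => by
  simp_rw [comp_add]; exact (hu k).add (hv k)

lemma MemLpOn.sub {B : Set E3} {s : ℝ≥0∞} {u v : E3 → HC} (hu : MemLpOn B s u)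
    (hv : MemLpOn B s v) : MemLpOn B s (fun x => u x - v x) := fun k => by
  simp_rw [comp_sub]; exact (hu k).sub (hv k)

lemma MemLpOn.star {B : Set E3} {s : ℝ≥0∞} {u : E3 → HC} (hu : MemLpOn B s u) :
    MemLpOn B s (fun x => star (u x)) := fun k => by
  simp_rw [comp_star]
  split_ifs
  exacts [hu k, (hu k).neg]

lemma MemLpOn.mul {B : Set E3} {s₁ s₂ s : ℝ≥0∞} [ENNReal.HolderTriple s₁ s₂ s] {u v : E3 → HC}
    (hu : MemLpOn B s₁ u) (hv : MemLpOn B s₂ v) : MemLpOn B s (fun x => u x * v x) := by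
  have h : ∀ i j, MemLp (fun x => comp i (u x) * comp j (v x)) s (volume.restrict B) :=
    fun i j => (hv j).mul (hu i)
  intro k
  fin_cases k
  · simp_rw [Fin.zero_eta, comp_mul_zero]
    exact (((h 0 0).sub (h 1 1)).sub (h 2 2)).sub (h 3 3)
  · simp_rw [Fin.mk_one, comp_mul_one]
    exact (((h 0 1).add (h 1 0)).add (h 2 3)).sub (h 3 2)
  · change MemLp (fun x => comp 2 (u x * v x)) _ _
    simp_rw [comp_mul_two]
    exact (((h 0 2).sub (h 1 3)).add (h 2 0)).add (h 3 1)
  · change MemLp (fun x => comp 3 (u x * v x)) _ _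
    simp_rw [comp_mul_three]
    exact (((h 0 3).add (h 1 2)).sub (h 2 1)).add (h 3 0)

lemma memLpOn_top_const (B : Set E3) (a : HC) : MemLpOn B ⊤ (fun _ => a) := fun _ =>
  memLp_top_const _

/-- Bounded coefficients: this is where the Vekua term is absorbed into the right-hand side at every
level of integrability. -/
lemma MemLpOn.vekuaQ {B : Set E3} {s : ℝ≥0∞} {A : Fin 4 → E3 → HC} {w : E3 → HC}
    (hA : ∀ j, MemLpOn B ⊤ (A j)) (hw : MemLpOn B s w) : MemLpOn B s (vekuaQ A w) :=
  (((hw.mul (hA 0)).add (hw.star.mul (hA 1))).add ((hA 2).mul hw)).add ((hA 3).mul hw.star)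

lemma LocIntegrableOn.memLpOn_one {G K : Set E3} {u : E3 → HC} (hu : LocIntegrableOn G u)
    (hK : IsCompact K) (hKG : K ⊆ G) : MemLpOn K 1 u := fun k =>
  memLp_one_iff_integrable.2 ((hu k).integrableOn_compact_subset hKG hK)

/-- The vector with the given real coordinates as a purely vectorial biquaternion. -/
def vecHC (f : Fin 3 → ℝ) : HC := ⟨0, f 0, f 1, f 2⟩

/-- The gradient of a real function as a purely vectorial biquaternion. -/
def gradHC (η : E3 → ℝ) (y : E3) : HC :=
  vecHC fun i => fderiv ℝ η y (EuclideanSpace.single i (1 : ℝ))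

lemma comp_vecHC (k : Fin 4) (f : Fin 3 → ℝ) :
    comp k (vecHC f) = ((![0, f 0, f 1, f 2] k : ℝ) : ℂ) := by
  fin_cases k <;> simp [comp, vecHC]

/-! ### The Dirac operator on the regularised kernel -/

lemma hasFDerivAt_fieldKer {t : ℝ} (ht : 0 < t) (j : Fin 3) (z : E3) :
    HasFDerivAt (fieldKer t j)
      (z j • ((-(3 / 2) : ℝ) * (‖z‖ ^ 2 + t) ^ (-(5 / 2) : ℝ)) • (2 : ℝ) • innerSL ℝ z +
        ((‖z‖ ^ 2 + t) ^ (-(3 / 2) : ℝ)) • (EuclideanSpace.proj j : E3 →L[ℝ] ℝ)) z := by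
  have h1 : HasFDerivAt (fun z : E3 => ‖z‖ ^ 2 + t) ((2 : ℝ) • innerSL ℝ z) z :=
    ((hasStrictFDerivAt_norm_sq z).hasFDerivAt.congr_fderiv (by ext; simp)).add_const t
  have h2 := h1.rpow_const (p := -(3 / 2)) (Or.inl (by positivity))
  have h3 : HasFDerivAt (fun z : E3 => z j) (EuclideanSpace.proj j : E3 →L[ℝ] ℝ) z :=
    (EuclideanSpace.proj j : E3 →L[ℝ] ℝ).hasFDerivAt
  refine (h3.mul h2).congr_fderiv ?_
  rw [show (-(3 / 2) - 1 : ℝ) = -(5 / 2) by norm_num]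

lemma fderiv_fieldKer_single {t : ℝ} (ht : 0 < t) (i j : Fin 3) (z : E3) :
    fderiv ℝ (fieldKer t j) z (EuclideanSpace.single i (1 : ℝ)) =
      (if i = j then (‖z‖ ^ 2 + t) ^ (-(3 / 2) : ℝ) else 0) -
        3 * (‖z‖ ^ 2 + t) ^ (-(5 / 2) : ℝ) * (z i * z j) := by
  rw [(hasFDerivAt_fieldKer ht j z).fderiv]
  simp [EuclideanSpace.inner_single_right, eq_comm (a := j)]
  ring

lemma contDiff_fieldKer {t : ℝ} (ht : 0 < t) (j : Fin 3) : ContDiff ℝ ∞ (fieldKer t j) := by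
  unfold fieldKer
  refine ContDiff.mul (EuclideanSpace.proj j : E3 →L[ℝ] ℝ).contDiff
    (ContDiff.rpow_const_of_ne ((contDiff_norm_sq ℝ).add contDiff_const) fun z => ?_)
  positivity

lemma sum_fderiv_fieldKer {t : ℝ} (ht : 0 < t) (z : E3) :
    ∑ i, fderiv ℝ (fieldKer t i) z (EuclideanSpace.single i (1 : ℝ)) = 3 * peakKer t z := by
  simp_rw [fderiv_fieldKer_single ht]
  have h1 : (‖z‖ ^ 2 + t) ^ (-(3 / 2) : ℝ) =
      (‖z‖ ^ 2 + t) ^ (-(5 / 2) : ℝ) * (‖z‖ ^ 2 + t) := by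
    rw [← Real.rpow_add_one (by positivity)]; norm_num
  have h2 : ‖z‖ ^ 2 = z 0 ^ 2 + z 1 ^ 2 + z 2 ^ 2 := by
    rw [EuclideanSpace.norm_sq_eq, Fin.sum_univ_three]
    simp
  rw [Fin.sum_univ_three, peakKer, h1]
  simp only [if_true]
  have h3 : ∀ a X : ℝ, X = z 0 ^ 2 + z 1 ^ 2 + z 2 ^ 2 → a * (X + t) - 3 * a * (z 0 * z 0) +
    (a * (X + t) - 3 * a * (z 1 * z 1)) + (a * (X + t) - 3 * a * (z 2 * z 2)) = 3 * (t * a) := by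
    rintro a X rfl; ring
  exact h3 _ _ h2

/-- The test function built from a cutoff function and the regularised Cauchy kernel. -/
def kernelTest (η : E3 → ℝ) (t : ℝ) (x y : E3) : HC :=
  vecHC fun j => η y * fieldKer t j (x - y)

lemma contDiff_fieldKer_sub {t : ℝ} (ht : 0 < t) (j : Fin 3) (x : E3) :
    ContDiff ℝ ∞ (fun y => fieldKer t j (x - y)) :=
  (contDiff_fieldKer ht j).comp (contDiff_const.sub contDiff_id)

lemma partialDeriv_vecHC {m : Fin 3 → E3 → ℝ} (hm : ∀ j, Differentiable ℝ (m j)) (i : Fin 3)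
    (y : E3) : partialDeriv i (fun y => vecHC fun j => m j y) y =
      vecHC fun j => fderiv ℝ (m j) y (EuclideanSpace.single i (1 : ℝ)) := by
  have h : ∀ j, fderiv ℝ (fun y => ((m j y : ℝ) : ℂ)) y (EuclideanSpace.single i (1 : ℝ)) =
      ((fderiv ℝ (m j) y (EuclideanSpace.single i (1 : ℝ)) : ℝ) : ℂ) := fun j => by
    have := (Complex.ofRealCLM.hasFDerivAt (x := m j y)).comp y (hm j y).hasFDerivAt
    rw [show (fun y => ((m j y : ℝ) : ℂ)) = Complex.ofRealCLM ∘ m j from rfl, this.fderiv]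
    simp
  ext
  · simp [partialDeriv, vecHC, comp]
  · exact h 0
  · exact h 1
  · exact h 2

lemma isTest_kernelTest {G : Set E3} {η : E3 → ℝ} (hη : ContDiff ℝ ∞ η)
    (hηc : HasCompactSupport η) (hηG : tsupport η ⊆ G) {t : ℝ} (ht : 0 < t) (x : E3) :
    IsTest G (kernelTest η t x) := by
  have hsub : Function.support (kernelTest η t x) ⊆ Function.support η := by
    intro y hy h
    apply hy
    have h' : η y = 0 := by simpa using h
    simp [kernelTest, vecHC, h']
    rfl
  refine ⟨fun k => ?_, hηc.mono hsub, (closure_mono hsub).trans hηG⟩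
  have h : ∀ j, ContDiff ℝ ∞ (fun y => ((η y * fieldKer t j (x - y) : ℝ) : ℂ)) := fun j =>
    Complex.ofRealCLM.contDiff.comp (hη.mul (contDiff_fieldKer_sub ht j x))
  fin_cases k
  exacts [contDiff_const, h 0, h 1, h 2]

/-- On vector fields `D` is -div + curl. The Jacobian of the kernel is symmetric (`hsym`), so the
curl vanishes, and the reflection y ↦ x - y turns -div into +div. The remaining sum comes from
differentiating the cutoff. -/
lemma diracOp_kernelTest {η : E3 → ℝ} (hη : ContDiff ℝ ∞ η) {t : ℝ} (ht : 0 < t) (x y : E3) :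
    diracOp (kernelTest η t x) y =
      ((η y * (3 * peakKer t (x - y)) : ℝ) : ℂ) • (1 : HC) +
        ∑ j, ((fieldKer t j (x - y) : ℝ) : ℂ) • (gradHC η y * unit j) := by
  have hd : ∀ j, HasFDerivAt (fun y => fieldKer t j (x - y))
      (-(fderiv ℝ (fieldKer t j) (x - y))) y := fun j => by
    have h1 : HasFDerivAt (fun y => x - y) (-(ContinuousLinearMap.id ℝ E3)) y :=
      (hasFDerivAt_id y).const_sub x
    have h2 := ((contDiff_fieldKer ht j).differentiable (by simp) (x - y)).hasFDerivAt
    exact (h2.comp y h1).congr_fderiv (by ext; simp)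
  have hη' : Differentiable ℝ η := hη.differentiable (by simp)
  have hpd : ∀ i, partialDeriv i (kernelTest η t x) y = vecHC fun j =>
      fderiv ℝ η y (EuclideanSpace.single i (1 : ℝ)) * fieldKer t j (x - y) -
      η y * fderiv ℝ (fieldKer t j) (x - y) (EuclideanSpace.single i (1 : ℝ)) := by
    intro i
    refine (partialDeriv_vecHC (m := fun j y => η y * fieldKer t j (x - y))
      (fun j => hη'.mul ((contDiff_fieldKer_sub ht j x).differentiable (by simp))) i y).trans ?_
    congr 1
    ext j
    rw [HasFDerivAt.fderiv (f := fun y => η y * fieldKer t j (x - y))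
      ((hη' y).hasFDerivAt.mul (hd j))]
    simp
    ring
  have htr := sum_fderiv_fieldKer ht (x - y)
  have hsym : ∀ i j, fderiv ℝ (fieldKer t j) (x - y) (EuclideanSpace.single i (1 : ℝ)) =
      fderiv ℝ (fieldKer t i) (x - y) (EuclideanSpace.single j (1 : ℝ)) := fun i j => by
    rw [fderiv_fieldKer_single ht, fderiv_fieldKer_single ht, mul_comm ((x - y) i)]
    simp only [eq_comm]
  rw [← htr]
  simp only [diracOp, hpd, Fin.sum_univ_three, gradHC]
  have h10 := hsym 1 0
  have h20 := hsym 2 0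
  have h21 := hsym 2 1
  ext <;> simp [unit, vecHC, h10, h20, h21] <;> ring

/-! ### Localisation of weak solutions -/

lemma comp_zero (k : Fin 4) : comp k 0 = 0 := by
  fin_cases k <;> rfl

/-- The density of the Cauchy potential representing a weak solution multiplied by a cutoff. -/
def cutDensity (η : E3 → ℝ) (u g : E3 → HC) (j : Fin 3) (y : E3) : HC :=
  (((η y : ℝ) : ℂ) • star (g y) - star (u y) * gradHC η y) * unit j

lemma gradHC_eq_zero {η : E3 → ℝ} {y : E3} (hy : y ∉ tsupport η) : gradHC η y = 0 := by
  have : fderiv ℝ η y = 0 := by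
    by_contra h
    exact hy (support_fderiv_subset ℝ (Function.mem_support.2 h))
  simp only [gradHC, this, vecHC]
  ext <;> simp

lemma cutDensity_eq_zero {η : E3 → ℝ} {y : E3} (hy : y ∉ tsupport η) (u g : E3 → HC)
    (j : Fin 3) : cutDensity η u g j y = 0 := by
  simp [cutDensity, gradHC_eq_zero hy, image_eq_zero_of_notMem_tsupport hy]

lemma memLp_of_restrict {f : E3 → ℂ} {B : Set E3} (hB : MeasurableSet B) {s : ℝ≥0∞}
    (hf : MemLp f s (volume.restrict B)) (h0 : ∀ y, y ∉ B → f y = 0) : MemLp f s volume := by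
  have : B.indicator f = f := indicator_eq_self.2 fun y hy => by
    by_contra h; exact hy (h0 y h)
  rw [← this]
  exact (memLp_indicator_iff_restrict hB).2 hf

lemma memLpOn_top_of_continuous {m : E3 → ℝ} (hm : Continuous m) (hc : HasCompactSupport m)
    (B : Set E3) : MemLp (fun y => ((m y : ℝ) : ℂ)) ⊤ (volume.restrict B) := by
  obtain ⟨C, hC⟩ := hc.exists_bound_of_continuous hm
  exact memLp_top_of_bound (by fun_prop) C (ae_of_all _ fun y => by
    rw [Complex.norm_real]; exact hC y)

lemma memLpOn_gradHC {η : E3 → ℝ} (hη : ContDiff ℝ ∞ η) (hηc : HasCompactSupport η)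
    (B : Set E3) : MemLpOn B ⊤ (gradHC η) := by
  have h : ∀ i, MemLp (fun y => ((fderiv ℝ η y (EuclideanSpace.single i (1 : ℝ)) : ℝ) : ℂ)) ⊤
      (volume.restrict B) := fun i =>
    memLpOn_top_of_continuous ((hη.continuous_fderiv (by simp)).clm_apply continuous_const)
      (hηc.fderiv_apply ℝ _) B
  intro k
  simp_rw [gradHC, comp_vecHC]
  fin_cases k
  · simp
  exacts [h 0, h 1, h 2]

lemma MemLpOn.ofReal_smul {η : E3 → ℝ} (hη : Continuous η) (hηc : HasCompactSupport η)
    {B : Set E3} {s : ℝ≥0∞} {u : E3 → HC} (hu : MemLpOn B s u) :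
    MemLpOn B s (fun y => ((η y : ℝ) : ℂ) • u y) := fun k => by
  simp_rw [comp_smul]
  exact (hu k).mul (memLpOn_top_of_continuous hη hηc B)

lemma memLpOn_cutDensity {η : E3 → ℝ} (hη : ContDiff ℝ ∞ η) (hηc : HasCompactSupport η)
    {B : Set E3} {s : ℝ≥0∞} {u g : E3 → HC} (hu : MemLpOn B s u) (hg : MemLpOn B s g)
    (j : Fin 3) : MemLpOn B s (cutDensity η u g j) :=
  (((hg.star.ofReal_smul hη.continuous hηc)).sub
    (hu.star.mul (memLpOn_gradHC hη hηc B))).mul (memLpOn_top_const B (unit j))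

lemma memLp_comp_cutDensity {η : E3 → ℝ} (hη : ContDiff ℝ ∞ η) (hηc : HasCompactSupport η)
    {B : Set E3} (hB : MeasurableSet B) (hηB : tsupport η ⊆ B) {s : ℝ≥0∞} {u g : E3 → HC}
    (hu : MemLpOn B s u) (hg : MemLpOn B s g) (k : Fin 4) (j : Fin 3) :
    MemLp (fun y => comp k (cutDensity η u g j y)) s volume :=
  memLp_of_restrict hB (memLpOn_cutDensity hη hηc hu hg j k) fun y hy => by
    rw [cutDensity_eq_zero fun h => hy (hηB h), comp_zero]

lemma memLp_ofReal_mul_comp {η : E3 → ℝ} (hη : Continuous η) (hηc : HasCompactSupport η)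
    {B : Set E3} (hB : MeasurableSet B) (hηB : tsupport η ⊆ B) {s : ℝ≥0∞} {u : E3 → HC}
    (hu : MemLpOn B s u) (k : Fin 4) :
    MemLp (fun y => ((η y : ℝ) : ℂ) * comp k (star (u y))) s volume := by
  refine memLp_of_restrict hB ?_ fun y hy => ?_
  · have := hu.star.ofReal_smul hη hηc k
    simp_rw [comp_smul] at this
    exact this
  · rw [image_eq_zero_of_notMem_tsupport fun h => hy (hηB h)]; simp

/-- Arranged so that the first summand is the integrand on the right of the weak equation; after
integration it cancels and the bracket has integral zero. -/
lemma comp_mul_diracOp_kernelTest {η : E3 → ℝ} (hη : ContDiff ℝ ∞ η) {t : ℝ} (ht : 0 < t)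
    (k : Fin 4) (x y : E3) (u g : E3 → HC) :
    comp k (star (u y) * diracOp (kernelTest η t x) y) =
      comp k (star (g y) * kernelTest η t x y) +
      ((3 * peakKer t (x - y)) • (((η y : ℝ) : ℂ) * comp k (star (u y))) -
        ∑ j, fieldKer t j (x - y) • comp k (cutDensity η u g j y)) := by
  have h1 : kernelTest η t x y =
      ∑ j, (((fieldKer t j (x - y) : ℝ) : ℂ) * ((η y : ℝ) : ℂ)) • unit j := by
    ext <;> simp [kernelTest, vecHC, unit, Fin.sum_univ_three, mul_comm]
  rw [diracOp_kernelTest hη ht, h1]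
  simp only [cutDensity, mul_add, Finset.mul_sum, mul_smul_comm, mul_one, comp_add, comp_sum,
    comp_smul, sub_mul, comp_sub, smul_mul_assoc, Complex.real_smul, mul_sub,
    Finset.sum_sub_distrib, mul_assoc]
  push_cast
  ring

lemma integrable_smul_of_continuous {F : E3 → ℂ} (hF : Integrable F volume) {K : Set E3}
    (hK : IsCompact K) (h0 : ∀ y, y ∉ K → F y = 0) {m : E3 → ℝ} (hm : Continuous m) :
    Integrable (fun y => m y • F y) volume :=
  (hF.integrableOn.continuousOn_smul hm.continuousOn hK).integrable_of_forall_notMem_eq_zero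
    fun y hy => by simp [h0 y hy]

/-- The mollifications of a localised weak solution are regularised potentials. -/
theorem integral_peakKer_eq_potentialReg {G : Set E3} {u g : E3 → HC}
    (h : IsWeakDirac G u g)
    {η : E3 → ℝ} (hη : ContDiff ℝ ∞ η) (hηc : HasCompactSupport η) (hηG : tsupport η ⊆ G)
    (k : Fin 4) {t : ℝ} (ht : 0 < t) (x : E3) :
    ∫ y, (3 * peakKer t (x - y)) • (((η y : ℝ) : ℂ) * comp k (star (u y))) =
      potentialReg t (fun j y => comp k (cutDensity η u g j y)) x := by
  obtain ⟨hu, hg, hw⟩ := h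
  have hK : IsCompact (tsupport η) := hηc
  have hu1 := hu.memLpOn_one hK hηG
  have hg1 := hg.memLpOn_one hK hηG
  have hKm := (isClosed_tsupport η).measurableSet
  have hw' := congrArg (comp k) (hw _ (isTest_kernelTest hη hηc hηG ht x))
  rw [comp_integralOn, comp_integralOn] at hw'
  simp_rw [comp_mul_diracOp_kernelTest hη ht k x _ u g] at hw'
  have hU : Integrable (fun y => ((η y : ℝ) : ℂ) * comp k (star (u y))) volume :=
    memLp_one_iff_integrable.1
      (memLp_ofReal_mul_comp hη.continuous hηc hKm subset_rfl hu1 k)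
  have hD : ∀ j, Integrable (fun y => comp k (cutDensity η u g j y)) volume := fun j =>
    memLp_one_iff_integrable.1 (memLp_comp_cutDensity hη hηc hKm subset_rfl hu1 hg1 k j)
  have hpeak : Continuous fun y => 3 * peakKer t (x - y) :=
    continuous_const.mul (continuous_const.mul (Continuous.rpow_const (by fun_prop) fun y =>
      Or.inl (by positivity)))
  have hI1 : Integrable (fun y => (3 * peakKer t (x - y)) •
      (((η y : ℝ) : ℂ) * comp k (star (u y)))) volume :=
    integrable_smul_of_continuous hU hK (fun y hy => by
      rw [image_eq_zero_of_notMem_tsupport hy]; simp) hpeak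
  have hI2 : Integrable (fun y => ∑ j, fieldKer t j (x - y) •
      comp k (cutDensity η u g j y)) volume :=
    integrable_finsetSum _ fun j _ => integrable_smul_of_continuous (hD j) hK (fun y hy => by
      rw [cutDensity_eq_zero hy, comp_zero]) (contDiff_fieldKer_sub ht j x).continuous
  have hT : ∀ y, y ∉ tsupport η → kernelTest η t x y = 0 := fun y hy => by
    simp only [kernelTest, image_eq_zero_of_notMem_tsupport hy, zero_mul, vecHC]
    ext <;> simp
  have hI3 : Integrable (fun y => comp k (star (g y) * kernelTest η t x y)) volume := by
    have hm : ∀ j, MemLp (fun y => ((η y * fieldKer t j (x - y) : ℝ) : ℂ)) ⊤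
        (volume.restrict (tsupport η)) := fun j =>
      memLpOn_top_of_continuous (hη.continuous.mul (contDiff_fieldKer_sub ht j x).continuous)
        hηc.mul_right _
    have hT' : MemLpOn (tsupport η) ⊤ (kernelTest η t x) := fun k => by
      simp_rw [kernelTest, comp_vecHC]
      fin_cases k
      · simp
      exacts [hm 0, hm 1, hm 2]
    refine memLp_one_iff_integrable.1 (memLp_of_restrict hKm (hg1.star.mul hT' k) fun y hy => ?_)
    rw [hT y hy, mul_zero, comp_zero]
  have hI12 : Integrable (fun y => (3 * peakKer t (x - y)) • (((η y : ℝ) : ℂ) *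
      comp k (star (u y))) - ∑ j, fieldKer t j (x - y) • comp k (cutDensity η u g j y)) volume :=
    hI1.sub hI2
  -- The remaining integrands vanish off the support of η, so integrals over G become integrals over
  -- the whole space.
  rw [integral_add hI3.integrableOn hI12.integrableOn, add_eq_left,
    integral_sub hI1.integrableOn hI2.integrableOn, sub_eq_zero,
    setIntegral_eq_integral_of_forall_compl_eq_zero fun y hy => by
      rw [image_eq_zero_of_notMem_tsupport fun h => hy (hηG h)]; simp,
    setIntegral_eq_integral_of_forall_compl_eq_zero fun y hy => by
      simp [cutDensity_eq_zero fun h => hy (hηG h), comp_zero]] at hw'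
  exact hw'

/-! ### Local regularity -/

lemma exists_cutoff (c : E3) {R₁ R₂ : ℝ} (h₁ : 0 < R₁) (h₂ : R₁ < R₂) :
    ∃ η : E3 → ℝ, ContDiff ℝ ∞ η ∧ HasCompactSupport η ∧ tsupport η ⊆ closedBall c R₂ ∧
      ∀ x ∈ closedBall c R₁, η x = 1 :=
  let f : ContDiffBump c := ⟨R₁, R₂, h₁, h₂⟩
  ⟨f, f.contDiff, f.hasCompactSupport, f.tsupport_eq.le, fun _ hx => f.one_of_mem_closedBall hx⟩

lemma comp_eq_comp_star (k : Fin 4) (a : HC) :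
    comp k a = (if k = 0 then (1 : ℝ) else -1) • comp k (star a) := by
  rw [comp_star]; split_ifs <;> simp

/-- Representation of a localised weak solution by a potential. -/
theorem exists_ae_eq_potential {G : Set E3} {u g : E3 → HC} (h : IsWeakDirac G u g)
    {c : E3} {R₁ R₂ : ℝ} (h₁ : 0 < R₁) (h₂ : R₁ < R₂) (hG : closedBall c R₂ ⊆ G) (k : Fin 4) :
    ∃ (D : Fin 3 → E3 → ℂ) (γ : ℝ), (∀ j, Integrable (D j) volume) ∧
      (∀ j y, y ∉ closedBall c R₂ → D j y = 0) ∧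
      (∀ s, MemLpOn (closedBall c R₂) s u → MemLpOn (closedBall c R₂) s g →
        ∀ j, MemLp (D j) s volume) ∧
      (fun x => comp k (u x)) =ᵐ[volume.restrict (closedBall c R₁)]
        γ • potentialReg 0 D := by
  obtain ⟨η, hη, hηc, hηB, hη1⟩ := exists_cutoff c h₁ h₂
  have hLp : ∀ s, MemLpOn (closedBall c R₂) s u → MemLpOn (closedBall c R₂) s g →
      ∀ j, MemLp (fun y => comp k (cutDensity η u g j y)) s volume := fun s hu hg j =>
    memLp_comp_cutDensity hη hηc measurableSet_closedBall hηB hu hg k j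
  have hu1 := h.1.memLpOn_one (isCompact_closedBall c R₂) hG
  have hg1 := h.2.1.memLpOn_one (isCompact_closedBall c R₂) hG
  have hD := fun j => memLp_one_iff_integrable.1 (hLp 1 hu1 hg1 j)
  refine ⟨fun j y => comp k (cutDensity η u g j y),
    (if k = 0 then (1 : ℝ) else -1) * (3 * ∫ z, peakKer 1 z)⁻¹, hD, fun j y hy => ?_, hLp, ?_⟩
  · simp only [cutDensity_eq_zero fun h => hy (hηB h), comp_zero]
  · have hU := memLp_one_iff_integrable.1
      (memLp_ofReal_mul_comp hη.continuous hηc measurableSet_closedBall hηB hu1 k)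
    have := ae_eq_potential hU hD fun t ht x =>
      integral_peakKer_eq_potentialReg h hη hηc (hηB.trans hG) k ht x
    filter_upwards [ae_restrict_of_ae this, ae_restrict_mem measurableSet_closedBall] with x hx hxB
    rw [hη1 x hxB] at hx
    rw [comp_eq_comp_star, Pi.smul_apply, mul_smul, ← hx]
    simp

/-- Gain of integrability for weak `D`-derivatives. -/
theorem IsWeakDirac.memLpOn_closedBall {G : Set E3} {u g : E3 → HC} (h : IsWeakDirac G u g)
    {c : E3} {R₁ R₂ : ℝ} (h₁ : 0 < R₁) (h₂ : R₁ < R₂) (hG : closedBall c R₂ ⊆ G) {p r : ℝ}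
    (hp : 1 < p) (hpr : p < r) (hrp : p⁻¹ - 1 / 3 < r⁻¹)
    (hu : MemLpOn (closedBall c R₂) (ENNReal.ofReal p) u)
    (hg : MemLpOn (closedBall c R₂) (ENNReal.ofReal p) g) :
    MemLpOn (closedBall c R₁) (ENNReal.ofReal r) u := by
  intro k
  obtain ⟨D, γ, hD, hD0, hDs, hrep⟩ := exists_ae_eq_potential h h₁ h₂ hG k
  have := memLp_potentialReg_restrict_ball hp hpr hrp hD (hDs _ hu hg) hD0
  exact (memLp_congr_ae hrep).2 ((this.mono_measure (Measure.restrict_mono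
    (closedBall_subset_closedBall h₂.le) le_rfl)).const_smul γ)

/-- Hölder continuity of functions with weak `D`-derivative in `L_r`, `r > 3`. -/
theorem IsWeakDirac.exists_holderWith {G : Set E3} {u g : E3 → HC} (h : IsWeakDirac G u g)
    {c : E3} {R₁ R₂ : ℝ} (h₁ : 0 < R₁) (h₂ : R₁ < R₂) (hG : closedBall c R₂ ⊆ G) {r : ℝ}
    (hr : 3 < r) (hu : MemLpOn (closedBall c R₂) (ENNReal.ofReal r) u)
    (hg : MemLpOn (closedBall c R₂) (ENNReal.ofReal r) g) (k : Fin 4) :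
    ∃ v : E3 → ℂ, (∃ C, HolderWith C (1 - 3 / r).toNNReal v) ∧
      (fun x => comp k (u x)) =ᵐ[volume.restrict (closedBall c R₁)] v := by
  obtain ⟨D, γ, hD, -, hDs, hrep⟩ := exists_ae_eq_potential h h₁ h₂ hG k
  obtain ⟨C, hC⟩ := exists_holderWith_potentialReg hr hD (hDs _ hu hg)
  exact ⟨_, ⟨_, hC.smul γ⟩, hrep⟩

lemma exists_closedBall_subset_of_lt {G : Set E3} (hG : IsOpen G) {c : E3} {R : ℝ} (hR : 0 < R)
    (h : closedBall c R ⊆ G) : ∃ δ > 0, closedBall c (R + δ) ⊆ G := by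
  obtain ⟨δ, hδ, hδG⟩ := (isCompact_closedBall c R).exists_cthickening_subset_open hG h
  exact ⟨δ, hδ, by rwa [cthickening_closedBall hδ.le hR.le, add_comm] at hδG⟩

/-- Gluing of local Hölder continuous representatives. -/
theorem mem_blocHolder_of_local {G : Set E3} (hG : IsOpen G) {w : E3 → HC} {ε : ℝ} (hε : 0 < ε)
    (h : ∀ (c : E3) (R : ℝ), 0 < R → closedBall c R ⊆ G → ∀ k, ∃ v : E3 → ℂ,
      (∃ C, HolderWith C ε.toNNReal v) ∧
        (fun x => comp k (w x)) =ᵐ[volume.restrict (closedBall c R)] v) :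
    w ∈ blocHolder G ε := by
  have hR : ∀ x : E3, ∃ R : ℝ, x ∈ G → 0 < R ∧ closedBall x R ⊆ G := fun x => by
    by_cases hx : x ∈ G
    · obtain ⟨R, hR, hRG⟩ := nhds_basis_closedBall.mem_iff.1 (hG.mem_nhds hx)
      exact ⟨R, fun _ => ⟨hR, hRG⟩⟩
    · exact ⟨0, fun h => absurd h hx⟩
  choose R hR using hR
  have hV : ∀ (x : E3) (k : Fin 4), ∃ v : E3 → ℂ, x ∈ G → (∃ C, HolderWith C ε.toNNReal v) ∧
      (fun x => comp k (w x)) =ᵐ[volume.restrict (closedBall x (R x))] v := fun x k => by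
    by_cases hx : x ∈ G
    · obtain ⟨v, hv⟩ := h x (R x) (hR x hx).1 (hR x hx).2 k
      exact ⟨v, fun _ => hv⟩
    · exact ⟨0, fun h => absurd h hx⟩
  choose V hV using hV
  have hcont : ∀ v : E3 → ℂ, (∃ C, HolderWith C ε.toNNReal v) → Continuous v := fun v ⟨C, hC⟩ =>
    hC.continuous (by simpa using hε)
  -- Two continuous representatives agree on the open overlap of their balls, so the diagonal value
  -- `V y k y` coincides with any continuous local representative near y.
  have key : ∀ (c : E3) (r : ℝ) (k : Fin 4) (v : E3 → ℂ), Continuous v →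
      (fun x => comp k (w x)) =ᵐ[volume.restrict (closedBall c r)] v →
      ∀ y ∈ ball c r, y ∈ G → V y k y = v y := by
    intro c r k v hv hvw y hy hyG
    have hrestr : ∀ {S T : Set E3} {f₁ f₂ : E3 → ℂ}, S ⊆ T → f₁ =ᵐ[volume.restrict T] f₂ →
      f₁ =ᵐ[volume.restrict S] f₂ := fun hST hf => ae_restrict_of_ae_restrict_of_subset hST hf
    have hU : IsOpen (ball c r ∩ ball y (R y)) := isOpen_ball.inter isOpen_ball
    have h1 := hrestr (inter_subset_left.trans ball_subset_closedBall :
      ball c r ∩ ball y (R y) ⊆ closedBall c r) hvw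
    have h2 := hrestr (inter_subset_right.trans ball_subset_closedBall :
      ball c r ∩ ball y (R y) ⊆ closedBall y (R y)) (hV y k hyG).2
    exact Measure.eqOn_open_of_ae_eq (h2.symm.trans h1) hU
      (hcont _ (hV y k hyG).1).continuousOn hv.continuousOn ⟨hy, mem_ball_self (hR y hyG).1⟩
  set u : E3 → HC := fun x => ⟨V x 0 x, V x 1 x, V x 2 x, V x 3 x⟩
  have hcu : ∀ k x, comp k (u x) = V x k x := fun k x => by fin_cases k <;> rfl
  refine ⟨u, ?_, fun c r hr hrG k => ?_⟩
  · have hk : ∀ k, ∀ᵐ x ∂volume.restrict G, comp k (w x) = comp k (u x) := by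
      intro k
      rw [ae_restrict_iff' hG.measurableSet, ae_iff]
      -- Uncountably many balls cover G, so the exceptional set is shown to be null locally.
      refine measure_null_of_locally_null _ fun x hx => ?_
      have hxG : x ∈ G := by
        simp only [mem_ofPred_eq, Classical.not_imp] at hx; exact hx.1
      refine ⟨_, inter_mem_nhdsWithin _ (ball_mem_nhds x (hR x hxG).1), ?_⟩
      have h1 := (ae_restrict_iff' measurableSet_closedBall).1 (hV x k hxG).2
      refine measure_mono_null (fun y hy => ?_) (ae_iff.1 h1)
      obtain ⟨hy1, hy2⟩ := hy
      simp only [mem_ofPred_eq, Classical.not_imp] at hy1 ⊢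
      refine ⟨ball_subset_closedBall hy2, fun h => hy1.2 ?_⟩
      rw [h, hcu, key x (R x) k _ (hcont _ (hV x k hxG).1) (hV x k hxG).2 y hy2 hy1.1]
    filter_upwards [hk 0, hk 1, hk 2, hk 3] with x h0 h1 h2 h3
    ext
    exacts [h0, h1, h2, h3]
  -- `key` only reaches the interior of a ball, hence a slightly larger one whose interior contains
  -- the closed ball.
  · obtain ⟨δ, hδ, hδG⟩ := exists_closedBall_subset_of_lt hG hr hrG
    obtain ⟨v, ⟨C, hC⟩, hvw⟩ := h c (r + δ) (by linarith) hδG k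
    have heq : ∀ y ∈ closedBall c r, comp k (u y) = v y := fun y hy => by
      rw [hcu]
      exact key c (r + δ) k v (hcont v ⟨C, hC⟩) hvw y
        (closedBall_subset_ball (by linarith) hy) (hrG hy)
    refine ⟨C, fun x hx y hy => ?_⟩
    simp only [heq x hx, heq y hy]
    exact hC x y

/-! ### Regularity for the Vekua equation -/

lemma MemLpOn.mono_exponent {G : Set E3} (hG : Bornology.IsBounded G) {s t : ℝ≥0∞} (h : s ≤ t)
    {u : E3 → HC} (hu : MemLpOn G t u) : MemLpOn G s u := fun k => by
  have : IsFiniteMeasure (volume.restrict G) := ⟨by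
    rw [Measure.restrict_apply_univ]; exact hG.measure_lt_top⟩
  exact (hu k).mono_exponent h

/-- Regularity of weak solutions of the Vekua equation, for `3/2 < p < 3 < r < p*`. -/
theorem IsWeakSol.mem_blocHolder {G : Set E3} (hGo : IsOpen G) (hGb : Bornology.IsBounded G)
    {A : Fin 4 → E3 → HC} (hA : ∀ j, MemLpOn G ⊤ (A j)) {p r : ℝ} (hp : 3 / 2 < p) (hp3 : p < 3)
    (hr : 3 < r) (hrp : r < sobolevExp p) {w v : E3 → HC} (hv : MemLpOn G (ENNReal.ofReal r) v)
    (hw : IsWeakSol G A (ENNReal.ofReal p) w v) : w ∈ blocHolder G (1 - 3 / r) := by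
  have hr0 : 0 < r := by linarith
  have hp0 : 0 < p := by linarith
  have hrp' : p⁻¹ - 1 / 3 < r⁻¹ := by
    have h1 : (sobolevExp p)⁻¹ = p⁻¹ - 1 / 3 := by
      have : 3 - p ≠ 0 := by linarith
      rw [sobolevExp]; field_simp
    rw [← h1]
    gcongr
  refine mem_blocHolder_of_local hGo (by rw [sub_pos, div_lt_one hr0]; exact hr)
    fun c R hR hRG k => ?_
  -- Each use of the representation costs some radius: the gain of integrability goes from R + δ to
  -- R + δ/2, the Hölder estimate from there to R.
  obtain ⟨δ, hδ, hδG⟩ := exists_closedBall_subset_of_lt hGo hR hRG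
  have hG2 : closedBall c (R + δ / 2) ⊆ G :=
    (closedBall_subset_closedBall (by linarith)).trans hδG
  obtain ⟨hwp, hwd⟩ := hw
  have hvp : MemLpOn G (ENNReal.ofReal p) v :=
    hv.mono_exponent hGb (ENNReal.ofReal_le_ofReal (by linarith))
  have hwr : MemLpOn (closedBall c (R + δ / 2)) (ENNReal.ofReal r) w :=
    hwd.memLpOn_closedBall (by linarith) (by linarith) hδG (by linarith) (by linarith) hrp'
      (hwp.mono_set hδG) (((MemLpOn.vekuaQ hA hwp).add hvp).mono_set hδG)
  exact hwd.exists_holderWith hR (by linarith) hG2 hr hwr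
    ((MemLpOn.vekuaQ (fun j => (hA j).mono_set hG2) hwr).add (hv.mono_set hG2)) k

/-- Regularity of weak solutions of the Vekua equation, for `p ≥ 3`. -/
theorem IsWeakSol.mem_blocHolder_of_three_le {G : Set E3} (hGo : IsOpen G)
    (hGb : Bornology.IsBounded G) {A : Fin 4 → E3 → HC} (hA : ∀ j, MemLpOn G ⊤ (A j)) {p r : ℝ}
    (hp3 : 3 ≤ p) (hr : 3 < r) {w v : E3 → HC} (hv : MemLpOn G (ENNReal.ofReal r) v)
    (hw : IsWeakSol G A (ENNReal.ofReal p) w v) : w ∈ blocHolder G (1 - 3 / r) := by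
  have h4 : 0 < r + 4 := by linarith
  -- The lowered exponent is the one with Sobolev exponent r + 1; it exceeds 3/2 because r > 2.
  have hlt : 3 * (r + 1) / (r + 4) < 3 := by rw [div_lt_iff₀ h4]; linarith
  refine IsWeakSol.mem_blocHolder hGo hGb hA (p := 3 * (r + 1) / (r + 4)) ?_ hlt hr ?_ hv
    ⟨hw.1.mono_exponent hGb (ENNReal.ofReal_le_ofReal (by linarith)), hw.2⟩
  · rw [lt_div_iff₀ h4]; linarith
  · have : sobolevExp (3 * (r + 1) / (r + 4)) = r + 1 := by
      have h9 : 3 - 3 * (r + 1) / (r + 4) = 9 / (r + 4) := by field_simp; ring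
      rw [sobolevExp, h9]; field_simp; ring
    linarith

lemma memLpOn_zero (G : Set E3) (s : ℝ≥0∞) : MemLpOn G s 0 := fun k => by
  simp [comp_zero]

end BiquatVekua

end

theorem mainTheorem8 (G : Set BiquatVekua.E3) (hGo : IsOpen G) (hGc : IsConnected G)
    (hGb : Bornology.IsBounded G)
    (A : Fin 4 → BiquatVekua.E3 → BiquatVekua.HC)
    (hA : ∀ j, BiquatVekua.MemLpOn G ⊤ (A j))
    (p : ℝ) (hp : 3 / 2 < p) :
    -- the nonhomogeneous equation
    (∀ (q : ℝ) (w v : BiquatVekua.E3 → BiquatVekua.HC), p ≤ q → 3 < q →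
      BiquatVekua.MemLpOn G (ENNReal.ofReal q) v →
      BiquatVekua.IsWeakSol G A (ENNReal.ofReal p) w v →
        (p < 3 → ∀ r : ℝ, 3 < r → r < min (BiquatVekua.sobolevExp p) q →
          w ∈ BiquatVekua.blocHolder G (1 - 3 / r)) ∧
        (3 ≤ p → ∀ r : ℝ, 3 < r → r ≤ q →
          w ∈ BiquatVekua.blocHolder G (1 - 3 / r))) ∧
    -- the homogeneous equation
    (p < 3 → ∀ r : ℝ, 3 < r → r < BiquatVekua.sobolevExp p →
      BiquatVekua.vekuaBergman G A (ENNReal.ofReal p) ⊆ BiquatVekua.blocHolder G (1 - 3 / r)) ∧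
    (3 ≤ p → ∀ r : ℝ, 3 < r →
      BiquatVekua.vekuaBergman G A (ENNReal.ofReal p) ⊆ BiquatVekua.blocHolder G (1 - 3 / r)) := by
  refine ⟨fun q w v _ _ hv hw => ⟨fun hp3 r hr hrm => ?_, fun hp3 r hr hrq => ?_⟩,
    fun hp3 r hr hrp w hw => ?_, fun hp3 r hr w hw => ?_⟩
  · exact hw.mem_blocHolder hGo hGb hA hp hp3 hr (hrm.trans_le (min_le_left _ _))
      (hv.mono_exponent hGb (ENNReal.ofReal_le_ofReal (hrm.trans_le (min_le_right _ _)).le))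
  · exact hw.mem_blocHolder_of_three_le hGo hGb hA hp3 hr
      (hv.mono_exponent hGb (ENNReal.ofReal_le_ofReal hrq))
  · exact BiquatVekua.IsWeakSol.mem_blocHolder hGo hGb hA hp hp3 hr hrp
      (BiquatVekua.memLpOn_zero G _) hw
  · exact BiquatVekua.IsWeakSol.mem_blocHolder_of_three_le hGo hGb hA hp3 hr
      (BiquatVekua.memLpOn_zero G _) hw
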